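/- Consider finite simple undirected graphs whose vertices are colored (each vertex has exactly one color, from an arbitrary color set), as structures with equality, the adjacency relation and one unary predicate for each color. Let $\mathrm{FO}^k$ be the set of first-order formulas, in negation normal form, that use at most $k$ distinct variables (which may be re-quantified). A sentence distinguishes $G$ from $H$ if it is true on $G$ and false on $H$. Let $D^k(G,H)$ and $A^k(G,H)$ be the minimum quantifier depth and the minimum alternation depth (the maximum length of a sequence of nested alternating quantifiers) of an $\mathrm{FO}^k$ sentence distinguishing $G$ from $H$; both are $\infty$ if there is no such sentence. Over colored trees, let $A^k(n)$ be the maximum of $A^k(T,T')$ over all pairs of colored trees $T,T'$ with $n$ vertices each that are distinguishable in $\mathrm{FO}^k$. **Theorem 3.** Let $k\ge 3$. 1. Let $T$ and $T'$ be colored trees, let $n\ge 2$ be the number of vertices of $T$ (the number of vertices of $T'$ is arbitrary), and suppose that $D^k(T,T')<\infty$. Then $D^k(T,T')<(k+3)\log_2 n$. 2. Consequently, over colored trees, $A^k(n)<(k+3)\log_2 n$ for every $n\ge 2$; in particular, $A^k(n)=O(\log n)$ as $n\to\infty$. -/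

import Mathlib

universe u v w

/-- A (vertex-)colored graph: a simple undirected graph on `V` together with a color from `C`
for every vertex. -/
structure ColoredGraph (C : Type*) (V : Type*) where
  graph : SimpleGraph V
  color : V → C

/-- A colored graph whose underlying graph is a tree (nonempty, connected, acyclic). -/
def ColoredGraph.IsTree {C V : Type*} (T : ColoredGraph C V) : Prop := T.graph.IsTree

/-- First-order formulas in negation normal form over the vocabulary of graphs with vertex colors
from `C` (equality, adjacency, and a unary predicate for every color), in which only the `k`
variables `x i`, `i : Fin k`, occur. A variable may be quantified repeatedly. -/
inductive FOk (C : Type*) (k : ℕ) where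
  | eq (i j : Fin k)
  | ne (i j : Fin k)
  | adj (i j : Fin k)
  | nadj (i j : Fin k)
  | col (c : C) (i : Fin k)
  | ncol (c : C) (i : Fin k)
  | and (φ ψ : FOk C k)
  | or (φ ψ : FOk C k)
  | ex (i : Fin k) (φ : FOk C k)
  | all (i : Fin k) (φ : FOk C k)

namespace FOk

variable {C V : Type*} {k : ℕ}

/-- Tarskian satisfaction in a colored graph under an assignment of the `k` variables. -/
def Sat (G : ColoredGraph C V) : FOk C k → (Fin k → V) → Prop
  | eq i j, a => a i = a j
  | ne i j, a => ¬ a i = a j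
  | adj i j, a => G.graph.Adj (a i) (a j)
  | nadj i j, a => ¬ G.graph.Adj (a i) (a j)
  | col c i, a => G.color (a i) = c
  | ncol c i, a => ¬ G.color (a i) = c
  | and φ ψ, a => Sat G φ a ∧ Sat G ψ a
  | or φ ψ, a => Sat G φ a ∨ Sat G ψ a
  | ex i φ, a => ∃ v : V, Sat G φ (Function.update a i v)
  | all i φ, a => ∀ v : V, Sat G φ (Function.update a i v)

/-- The variables that occur free. -/
def freeVars : FOk C k → Finset (Fin k)
  | eq i j => {i, j}
  | ne i j => {i, j}
  | adj i j => {i, j}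
  | nadj i j => {i, j}
  | col _ i => {i}
  | ncol _ i => {i}
  | and φ ψ => freeVars φ ∪ freeVars ψ
  | or φ ψ => freeVars φ ∪ freeVars ψ
  | ex i φ => (freeVars φ).erase i
  | all i φ => (freeVars φ).erase i

/-- Quantifier depth. -/
def quantDepth : FOk C k → ℕ
  | and φ ψ => max (quantDepth φ) (quantDepth ψ)
  | or φ ψ => max (quantDepth φ) (quantDepth ψ)
  | ex _ φ => quantDepth φ + 1
  | all _ φ => quantDepth φ + 1
  | _ => 0

/-- `altFrom true φ` (`altFrom false φ`) is the maximum length of a sequence of nested quantifiers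
in `φ` that starts with `∃` (with `∀`) and in which `∃` and `∀` alternate. -/
def altFrom : Bool → FOk C k → ℕ
  | b, and φ ψ => max (altFrom b φ) (altFrom b ψ)
  | b, or φ ψ => max (altFrom b φ) (altFrom b ψ)
  | true, ex _ φ => max (altFrom true φ) (altFrom false φ + 1)
  | false, ex _ φ => altFrom false φ
  | true, all _ φ => altFrom true φ
  | false, all _ φ => max (altFrom false φ) (altFrom true φ + 1)
  | _, _ => 0

/-- Alternation depth: the maximum length of a sequence of nested alternating quantifiers. -/
def altDepth (φ : FOk C k) : ℕ := max (altFrom true φ) (altFrom false φ)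

/-- A formula without free variables. -/
def IsSentence (φ : FOk C k) : Prop := φ.freeVars = ∅

/-- Truth of a sentence in a colored graph. -/
def TrueOn (φ : FOk C k) (G : ColoredGraph C V) : Prop := ∀ a : Fin k → V, φ.Sat G a

/-- The sentence `φ` distinguishes `G` from `H`: it is true on `G` and false on `H`. -/
def Distinguishes {W : Type*} (φ : FOk C k) (G : ColoredGraph C V) (H : ColoredGraph C W) : Prop :=
  φ.IsSentence ∧ φ.TrueOn G ∧ ¬ φ.TrueOn H

end FOk

/-- `D^k(G, H)`: the minimum quantifier depth of a `k`-variable sentence that distinguishes `G`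
from `H`, and `⊤` if there is none. -/
noncomputable def distDepth (k : ℕ) {C V W : Type*}
    (G : ColoredGraph C V) (H : ColoredGraph C W) : ℕ∞ :=
  ⨅ (φ : FOk C k) (_ : φ.Distinguishes G H), (φ.quantDepth : ℕ∞)

/-- `A^k(G, H)`: the minimum alternation depth of a `k`-variable sentence that distinguishes `G`
from `H`, and `⊤` if there is none. -/
noncomputable def distAlt (k : ℕ) {C V W : Type*}
    (G : ColoredGraph C V) (H : ColoredGraph C W) : ℕ∞ :=
  ⨅ (φ : FOk C k) (_ : φ.Distinguishes G H), (φ.altDepth : ℕ∞)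

/-- The alternation function `A^k(n)` over colored trees: the largest value of `A^k(T, T')` over
all pairs of colored trees `T`, `T'` with `n` vertices each (and with any set of colors) that are
distinguishable in `k`-variable logic. -/
noncomputable def treeAltFun (k n : ℕ) : ℕ∞ :=
  sSup {a : ℕ∞ | ∃ (C : Type u) (V : Type v) (W : Type w)
    (T : ColoredGraph C V) (T' : ColoredGraph C W),
    Finite V ∧ Finite W ∧ Nat.card V = n ∧ Nat.card W = n ∧ T.IsTree ∧ T'.IsTree ∧
    (∃ φ : FOk C k, φ.Distinguishes T T') ∧ a = distAlt k T T'}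

/-!
The depth needed to distinguish two graphs is the length of a pebble game which Spoiler wins. Root
`T` and `T'` at vertices `z` and `z'` and let the type of a vertex be its color together with the
number of its children of each type, counted up to `k`. If the types of the two roots agree for
some `z` and `z'`, then Duplicator can keep all pebbles inside a type-preserving partial
isomorphism, so `T` and `T'` are indistinguishable. Otherwise Spoiler pebbles a centroid `z` of `T`,
and whatever `z'` Duplicator answers, the types of `z` and `z'` differ. From two branches of
different types Spoiler reaches two smaller ones: he moves to the last vertex whose branch has more
than half of the size, compares the path from the root to it by binary search, and finds a child
type of different multiplicity, which he exhibits by at most `k` pebbles. The search pays for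
itself by the vertices hanging off the path, so a halving of the size costs `k + 3` rounds.
-/

/-! ### The pebble game -/

namespace FOk

variable {C V W : Type*} {k : ℕ} {G : ColoredGraph C V} {H : ColoredGraph C W}

/-- The negation of a formula; it is again in negation normal form and has the same quantifier
depth. -/
def neg : FOk C k → FOk C k
  | eq i j => ne i j
  | ne i j => eq i j
  | adj i j => nadj i j
  | nadj i j => adj i j
  | col c i => ncol c i
  | ncol c i => col c i
  | and φ ψ => or (neg φ) (neg ψ)
  | or φ ψ => and (neg φ) (neg ψ)
  | ex i φ => all i (neg φ)
  | all i φ => ex i (neg φ)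

theorem quantDepth_neg (φ : FOk C k) : φ.neg.quantDepth = φ.quantDepth := by
  induction φ <;> simp_all [neg, quantDepth]

theorem freeVars_neg (φ : FOk C k) : φ.neg.freeVars = φ.freeVars := by
  induction φ <;> simp_all [neg, freeVars]

theorem sat_neg (φ : FOk C k) (p : Fin k → V) : φ.neg.Sat G p ↔ ¬ φ.Sat G p := by
  induction φ generalizing p <;> simp_all [neg, Sat, imp_iff_not_or]

/-- The conjunction of a formula and a list of formulas, for describing all the possible answers
to a move at once. The formula `φ` stands apart because the syntax has no empty conjunction. -/
def conj (φ : FOk C k) (l : List (FOk C k)) : FOk C k := l.foldr and φ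

theorem sat_conj (φ : FOk C k) (l : List (FOk C k)) (p : Fin k → V) :
    (conj φ l).Sat G p ↔ φ.Sat G p ∧ ∀ ψ ∈ l, ψ.Sat G p := by
  induction l with
  | nil => simp [conj]
  | cons ψ l ih => simp_all [conj, Sat, and_left_comm]

theorem quantDepth_conj_le {φ : FOk C k} {l : List (FOk C k)} {r : ℕ} (hφ : φ.quantDepth ≤ r)
    (hl : ∀ ψ ∈ l, ψ.quantDepth ≤ r) : (conj φ l).quantDepth ≤ r := by
  induction l with
  | nil => exact hφ
  | cons ψ l ih => simp_all [conj, quantDepth]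

theorem freeVars_conj_subset {φ : FOk C k} {l : List (FOk C k)} {S : Finset (Fin k)}
    (hφ : φ.freeVars ⊆ S) (hl : ∀ ψ ∈ l, ψ.freeVars ⊆ S) : (conj φ l).freeVars ⊆ S := by
  induction l with
  | nil => exact hφ
  | cons ψ l ih => simp_all [conj, freeVars, Finset.union_subset_iff]

theorem sat_congr (φ : FOk C k) {p q : Fin k → V} (h : ∀ i ∈ φ.freeVars, p i = q i) :
    φ.Sat G p ↔ φ.Sat G q := by
  have update_eq {i : Fin k} {S : Finset (Fin k)} {p q : Fin k → V}
      (h : ∀ j ∈ S.erase i, p j = q j) (x : V) :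
      ∀ j ∈ S, Function.update p i x j = Function.update q i x j := by
    intro j hj
    by_cases hji : j = i
    · simp [hji]
    · simpa [hji] using h j (Finset.mem_erase.2 ⟨hji, hj⟩)
  induction φ generalizing p q with
  | and φ ψ ihφ ihψ =>
    exact and_congr (ihφ fun i hi => h i (Finset.mem_union_left _ hi))
      (ihψ fun i hi => h i (Finset.mem_union_right _ hi))
  | or φ ψ ihφ ihψ =>
    exact or_congr (ihφ fun i hi => h i (Finset.mem_union_left _ hi))
      (ihψ fun i hi => h i (Finset.mem_union_right _ hi))
  | ex i φ ih => exact exists_congr fun x => ih (update_eq h x)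
  | all i φ ih => exact forall_congr' fun x => ih (update_eq h x)
  | _ => simp_all [Sat, freeVars]

theorem altFrom_le_quantDepth (φ : FOk C k) (b : Bool) : φ.altFrom b ≤ φ.quantDepth := by
  induction φ generalizing b with
  | and φ ψ ihφ ihψ => cases b <;> exact max_le_max (ihφ _) (ihψ _)
  | or φ ψ ihφ ihψ => cases b <;> exact max_le_max (ihφ _) (ihψ _)
  | ex i φ ih | all i φ ih =>
    have := ih true
    have := ih false
    cases b <;> simp only [altFrom, quantDepth] <;> omega
  | _ => cases b <;> simp [altFrom, quantDepth]

theorem altDepth_le_quantDepth (φ : FOk C k) : φ.altDepth ≤ φ.quantDepth :=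
  max_le (φ.altFrom_le_quantDepth true) (φ.altFrom_le_quantDepth false)

/-- A back-and-forth system between `G` and `H`: a set of pairs of assignments along which atomic
formulas are preserved and which Duplicator can maintain forever when variables are
reassigned. -/
structure IsBackAndForth (G : ColoredGraph C V) (H : ColoredGraph C W)
    (E : (Fin k → V) → (Fin k → W) → Prop) : Prop where
  eq_iff : ∀ {p q}, E p q → ∀ i j, p i = p j ↔ q i = q j
  adj_iff : ∀ {p q}, E p q → ∀ i j, G.graph.Adj (p i) (p j) ↔ H.graph.Adj (q i) (q j)
  color_eq : ∀ {p q}, E p q → ∀ i, G.color (p i) = H.color (q i)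
  forth : ∀ {p q}, E p q → ∀ i x, ∃ x', E (Function.update p i x) (Function.update q i x')
  back : ∀ {p q}, E p q → ∀ i x', ∃ x, E (Function.update p i x) (Function.update q i x')

theorem IsBackAndForth.sat_iff {E : (Fin k → V) → (Fin k → W) → Prop} (hE : IsBackAndForth G H E)
    (φ : FOk C k) {p : Fin k → V} {q : Fin k → W} (h : E p q) : φ.Sat G p ↔ φ.Sat H q := by
  induction φ generalizing p q with
  | eq i j => exact hE.eq_iff h i j
  | ne i j => exact not_congr (hE.eq_iff h i j)
  | adj i j => exact hE.adj_iff h i j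
  | nadj i j => exact not_congr (hE.adj_iff h i j)
  | col c i => simp only [Sat, hE.color_eq h i]
  | ncol c i => simp only [Sat, hE.color_eq h i]
  | and φ ψ ihφ ihψ => exact and_congr (ihφ h) (ihψ h)
  | or φ ψ ihφ ihψ => exact or_congr (ihφ h) (ihψ h)
  | ex i φ ih =>
    constructor
    · rintro ⟨x, hx⟩
      obtain ⟨x', hxx'⟩ := hE.forth h i x
      exact ⟨x', (ih hxx').1 hx⟩
    · rintro ⟨x', hx'⟩
      obtain ⟨x, hxx'⟩ := hE.back h i x'
      exact ⟨x, (ih hxx').2 hx'⟩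
  | all i φ ih =>
    constructor
    · intro hφ x'
      obtain ⟨x, hxx'⟩ := hE.back h i x'
      exact (ih hxx').1 (hφ x)
    · intro hφ x
      obtain ⟨x', hxx'⟩ := hE.forth h i x
      exact (ih hxx').2 (hφ x')

end FOk

theorem distAlt_le_distDepth (k : ℕ) {C V W : Type*} (G : ColoredGraph C V)
    (H : ColoredGraph C W) : distAlt k G H ≤ distDepth k G H :=
  iInf_mono fun φ => iInf_mono fun _ => by exact_mod_cast φ.altDepth_le_quantDepth

section Pebbles

variable {k : ℕ} {V W : Type*} {p : Fin k → V} {q : Fin k → W} {S : Finset (Fin k)}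
  {L : List (V × W)}

/-- The pebbles with indices in `S` lie on all the pairs of `L`. Other pebbles may be on the board,
so forgetting some of the pairs needs no move. -/
def Pebbles (p : Fin k → V) (q : Fin k → W) (S : Finset (Fin k)) (L : List (V × W)) : Prop :=
  ∀ x ∈ L, ∃ i ∈ S, (p i, q i) = x

theorem Pebbles.exists_subset (h : Pebbles p q S L) :
    ∃ S₀ ⊆ S, S₀.card ≤ L.length ∧ Pebbles p q S₀ L := by
  induction L with
  | nil => exact ⟨∅, by simp, by simp, by simp [Pebbles]⟩
  | cons x L ih =>
    obtain ⟨S₀, hS₀, hcard, hL⟩ := ih fun y hy => h y (List.mem_cons_of_mem x hy)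
    obtain ⟨i, hiS, hi⟩ := h x List.mem_cons_self
    refine ⟨insert i S₀, Finset.insert_subset hiS hS₀,
      (Finset.card_insert_le i S₀).trans (Nat.succ_le_succ hcard), fun y hy => ?_⟩
    rcases List.mem_cons.1 hy with rfl | hy
    · exact ⟨i, Finset.mem_insert_self i S₀, hi⟩
    · obtain ⟨j, hj, hjy⟩ := hL y hy
      exact ⟨j, Finset.mem_insert_of_mem hj, hjy⟩

theorem Pebbles.update (h : Pebbles p q S L) {i : Fin k} (hi : i ∉ S) (x : V) (x' : W) :
    Pebbles (Function.update p i x) (Function.update q i x') (insert i S) ((x, x') :: L) := by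
  intro y hy
  rcases List.mem_cons.1 hy with rfl | hy
  · exact ⟨i, by simp, by simp⟩
  · obtain ⟨j, hj, hjy⟩ := h y hy
    have hji : j ≠ i := fun e => hi (e ▸ hj)
    exact ⟨j, by simp [hj], by simpa [hji] using hjy⟩

end Pebbles

/-- Spoiler wins the `r`-round `k`-pebble game on `G` and `H` from any position in which the pairs
of `L` are pebbled. The game is played in terms of formulas: some formula of quantifier depth at
most `r` about the pebbled vertices holds in `G` and fails in `H`. -/
def SpoilerWins (k : ℕ) {C V W : Type*} (G : ColoredGraph C V) (H : ColoredGraph C W) (r : ℕ)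
    (L : List (V × W)) : Prop :=
  ∀ (p : Fin k → V) (q : Fin k → W) (S : Finset (Fin k)), Pebbles p q S L →
    ∃ φ : FOk C k, φ.quantDepth ≤ r ∧ φ.freeVars ⊆ S ∧ φ.Sat G p ∧ ¬ φ.Sat H q

namespace SpoilerWins

variable {k : ℕ} {C V W : Type*} {G : ColoredGraph C V} {H : ColoredGraph C W} {r s : ℕ}
  {L M : List (V × W)} {x y : V} {x' y' : W}

theorem mono (h : SpoilerWins k G H r L) (hrs : r ≤ s) (hLM : L ⊆ M) : SpoilerWins k G H s M := by
  intro p q S hM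
  obtain ⟨φ, hdepth, hφ⟩ := h p q S fun x hx => hM x (hLM hx)
  exact ⟨φ, hdepth.trans hrs, hφ⟩

theorem swap (h : SpoilerWins k G H r L) : SpoilerWins k H G r (L.map Prod.swap) := by
  intro p q S hS
  have hL : Pebbles q p S L := fun x hx => by
    obtain ⟨i, hi, hpq⟩ := hS x.swap (List.mem_map_of_mem hx)
    exact ⟨i, hi, Prod.swap_inj.1 hpq⟩
  obtain ⟨φ, hdepth, hfree, hG, hH⟩ := h q p S hL
  exact ⟨φ.neg, by rwa [FOk.quantDepth_neg], by rwa [FOk.freeVars_neg], by rwa [FOk.sat_neg],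
    by rwa [FOk.sat_neg, not_not]⟩

theorem of_swap (h : SpoilerWins k H G r (L.map Prod.swap)) : SpoilerWins k G H r L := by
  simpa using h.swap

theorem of_atomic (hx : (x, x') ∈ L) (hy : (y, y') ∈ L)
    (h : ∀ i j : Fin k, ∃ φ : FOk C k, φ.quantDepth = 0 ∧ φ.freeVars ⊆ {i, j} ∧
      ∀ (p : Fin k → V) (q : Fin k → W), p i = x → p j = y → q i = x' → q j = y' →
        φ.Sat G p ∧ ¬ φ.Sat H q) : SpoilerWins k G H r L := by
  intro p q S hS
  obtain ⟨i, hiS, hi⟩ := hS _ hx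
  obtain ⟨j, hjS, hj⟩ := hS _ hy
  obtain ⟨φ, hdepth, hfree, hsat⟩ := h i j
  rw [Prod.mk.injEq] at hi hj
  exact ⟨φ, by simp [hdepth], hfree.trans (by simp [Finset.insert_subset_iff, hiS, hjS]),
    hsat p q hi.1 hj.1 hi.2 hj.2⟩

theorem of_eq (hx : (x, x') ∈ L) (hy : (y, y') ∈ L) (h : ¬ (x = y ↔ x' = y')) :
    SpoilerWins k G H r L := by
  refine of_atomic hx hy fun i j => ?_
  by_cases hxy : x = y
  · exact ⟨.eq i j, rfl, subset_rfl, fun p q hpi hpj hqi hqj => by simp_all [FOk.Sat]⟩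
  · exact ⟨.ne i j, rfl, subset_rfl, fun p q hpi hpj hqi hqj => by simp_all [FOk.Sat]⟩

theorem of_adj (hx : (x, x') ∈ L) (hy : (y, y') ∈ L)
    (h : ¬ (G.graph.Adj x y ↔ H.graph.Adj x' y')) : SpoilerWins k G H r L := by
  refine of_atomic hx hy fun i j => ?_
  by_cases hxy : G.graph.Adj x y
  · exact ⟨.adj i j, rfl, subset_rfl, fun p q hpi hpj hqi hqj => by simp_all [FOk.Sat]⟩
  · exact ⟨.nadj i j, rfl, subset_rfl, fun p q hpi hpj hqi hqj => by simp_all [FOk.Sat]⟩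

theorem of_color (hx : (x, x') ∈ L) (h : G.color x ≠ H.color x') : SpoilerWins k G H r L :=
  of_atomic hx hx fun i _ => ⟨.col (G.color x) i, rfl, by simp [FOk.freeVars],
    fun p q hp _ hq _ => by simp [FOk.Sat, hp, hq, h.symm]⟩

theorem step [Finite W] [Nonempty W] (hL : L.length < k) (x : V)
    (h : ∀ x', SpoilerWins k G H r ((x, x') :: L)) : SpoilerWins k G H (r + 1) L := by
  intro p q S hS
  obtain ⟨S₀, hS₀, hcard, hpq⟩ := hS.exists_subset
  obtain ⟨i, hi⟩ : ∃ i, i ∉ S₀ := by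
    by_contra! hall
    have := Finset.eq_univ_of_forall hall ▸ hcard
    rw [Finset.card_univ, Fintype.card_fin] at this
    omega
  choose f hdepth hfree hG hH using fun x' => h x' _ _ _ (hpq.update hi x x')
  have := Fintype.ofFinite W
  let φ := FOk.conj (f (Classical.arbitrary W)) (Finset.univ.toList.map f)
  refine ⟨.ex i φ, ?_, ?_, ⟨x, ?_⟩, ?_⟩
  · exact Nat.succ_le_succ (FOk.quantDepth_conj_le (hdepth _) (by simpa using hdepth))
  · have hφ : φ.freeVars ⊆ insert i S₀ :=
      FOk.freeVars_conj_subset (hfree _) (by simpa using hfree)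
    exact (Finset.subset_insert_iff.1 hφ).trans hS₀
  · exact (FOk.sat_conj _ _ _).2 ⟨hG _, by simpa using hG⟩
  · rintro ⟨x', hx'⟩
    exact hH x' (((FOk.sat_conj _ _ _).1 hx').2 _ (by simp))

theorem step_right [Finite V] [Nonempty V] (hL : L.length < k) (x' : W)
    (h : ∀ x, SpoilerWins k G H r ((x, x') :: L)) : SpoilerWins k G H (r + 1) L :=
  of_swap <| step (by simpa using hL) x' fun x => (h x).swap

theorem distDepth_le [Nonempty V] [Nonempty W] (h : SpoilerWins k G H r []) :
    distDepth k G H ≤ r := by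
  obtain ⟨φ, hdepth, hfree, hG, hH⟩ :=
    h (fun _ => Classical.arbitrary V) (fun _ => Classical.arbitrary W) ∅ (by simp [Pebbles])
  have hφ : φ.freeVars = ∅ := Finset.subset_empty.1 hfree
  refine iInf₂_le_of_le φ ⟨hφ, fun a => ?_, fun h => hH (h _)⟩ (by exact_mod_cast hdepth)
  exact (φ.sat_congr (by simp [hφ])).1 hG

end SpoilerWins

/-! ### Rooted trees -/

section Tree

open SimpleGraph

variable {V : Type*} {G : SimpleGraph V} {a b c t w x y z : V}

/-- In a connected graph, the vertex `z` lies on a shortest walk from `a` to `t`. -/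
abbrev Between (G : SimpleGraph V) (a z t : V) : Prop := G.dist a z + G.dist z t = G.dist a t

theorem Between.symm (h : Between G a z t) : Between G t z a := by
  rw [Between, dist_comm (u := t) (v := z), dist_comm (u := z) (v := a),
    dist_comm (u := t) (v := a), add_comm]
  exact h

theorem ne_of_dist_eq_dist {W : Type*} {H : SimpleGraph W} {a' z' : W} (hG : G.Connected)
    (haz : a ≠ z) (h : G.dist a z = H.dist a' z') : a' ≠ z' := by
  rintro rfl
  exact haz (hG.dist_eq_zero_iff.1 (by simpa using h))

theorem exists_between_of_le_dist (hG : G.Connected) {n : ℕ} (hn : n ≤ G.dist a t) :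
    ∃ z, Between G a z t ∧ G.dist a z = n := by
  obtain ⟨p, hp⟩ := hG.exists_walk_length_eq_dist a t
  have hleft : G.dist a (p.getVert n) ≤ n :=
    (dist_le (p.take n)).trans (by rw [Walk.take_length]; exact min_le_left _ _)
  have hright : G.dist (p.getVert n) t ≤ G.dist a t - n :=
    (dist_le (p.drop n)).trans (by rw [Walk.drop_length, hp])
  have htri := hG.dist_triangle (u := a) (v := p.getVert n) (w := t)
  exact ⟨p.getVert n, by omega, by omega⟩

theorem Between.eq_of_dist_eq (hG : G.IsTree) (hx : Between G a x t) (hz : Between G a z t)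
    (h : G.dist a x = G.dist a z) : x = z := by
  have exists_path {y : V} (hy : Between G a y t) :
      ∃ p : G.Walk a t, p.IsPath ∧ p.getVert (G.dist a y) = y := by
    obtain ⟨p, hp⟩ := hG.connected.exists_walk_length_eq_dist a y
    obtain ⟨q, hq⟩ := hG.connected.exists_walk_length_eq_dist y t
    refine ⟨p.append q, Walk.isPath_of_length_eq_dist _ ?_, ?_⟩
    · rw [Walk.length_append, hp, hq, hy]
    · simp [Walk.getVert_append, hp]
  obtain ⟨p, hp, hpx⟩ := exists_path hx
  obtain ⟨q, hq, hqz⟩ := exists_path hz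
  rw [← hpx, ← hqz, (hG.existsUnique_path a t).unique hp hq, h]

open Classical in
/-- The parent of `w` in the tree `G` rooted at `a`, that is, the neighbor of `w` on the way to
`a`. The root is its own parent. -/
noncomputable def parent (G : SimpleGraph V) (a w : V) : V :=
  if h : ∃ b, G.Adj b w ∧ G.dist a b + 1 = G.dist a w then h.choose else w

theorem parent_self : parent G a a = a := by
  rw [parent, dif_neg]
  simp

theorem parent_spec (hG : G.Connected) (h : a ≠ w) :
    G.Adj (parent G a w) w ∧ G.dist a (parent G a w) + 1 = G.dist a w := by
  have hpos := hG.pos_dist_of_ne h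
  obtain ⟨b, hb, hab⟩ := exists_between_of_le_dist hG (Nat.sub_le (G.dist a w) 1)
  have hex : ∃ b, G.Adj b w ∧ G.dist a b + 1 = G.dist a w :=
    ⟨b, dist_eq_one_iff_adj.1 (by omega), by omega⟩
  rw [parent, dif_pos hex]
  exact hex.choose_spec

theorem adj_parent (hG : G.Connected) (h : a ≠ w) : G.Adj (parent G a w) w := (parent_spec hG h).1

theorem dist_parent_add_one (hG : G.Connected) (h : a ≠ w) :
    G.dist a (parent G a w) + 1 = G.dist a w :=
  (parent_spec hG h).2

theorem parent_eq_of_adj (hG : G.IsTree) (hb : G.Adj b w) (h : G.dist a b + 1 = G.dist a w) :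
    parent G a w = b := by
  have hne : a ≠ w := by
    rintro rfl
    simp at h
  obtain ⟨hadj, hdist⟩ := parent_spec hG.connected hne
  rw [← dist_eq_one_iff_adj] at hadj hb
  exact Between.eq_of_dist_eq hG (a := a) (t := w) (by omega) (by omega) (by omega)

theorem parent_of_adj (hG : G.IsTree) (h : G.Adj a w) : parent G a w = a :=
  parent_eq_of_adj hG h (by rw [dist_self, dist_eq_one_iff_adj.2 h])

theorem dist_of_ne_parent (hG : G.IsTree) (h : G.Adj w x) (hx : x ≠ parent G a w) :
    G.dist a x = G.dist a w + 1 :=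
  (hG.dist_eq_dist_add_one_of_adj a h).resolve_left fun hdist =>
    hx (parent_eq_of_adj hG h.symm hdist.symm).symm

theorem adj_iff_parent (hG : G.IsTree) (a : V) :
    G.Adj x y ↔ (x ≠ a ∧ parent G a x = y) ∨ (y ≠ a ∧ parent G a y = x) := by
  constructor
  · intro h
    rcases hG.dist_eq_dist_add_one_of_adj a h with hdist | hdist
    · exact .inl ⟨by rintro rfl; simp at hdist, parent_eq_of_adj hG h.symm hdist.symm⟩
    · exact .inr ⟨by rintro rfl; simp at hdist, parent_eq_of_adj hG h hdist.symm⟩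
  · rintro (⟨h, rfl⟩ | ⟨h, rfl⟩)
    · exact (adj_parent hG.connected h.symm).symm
    · exact adj_parent hG.connected h.symm

theorem Between.parent_eq (hG : G.IsTree) (h : Between G a z t) (hz : z ≠ t) :
    parent G a t = parent G z t := by
  obtain ⟨hadj, hdist⟩ := parent_spec hG.connected hz
  have htri := hG.connected.dist_triangle (u := a) (v := z) (w := parent G z t)
  have htri' := hG.connected.dist_triangle (u := a) (v := parent G z t) (w := t)
  have hone := dist_eq_one_iff_adj.2 hadj
  exact parent_eq_of_adj hG hadj (by omega)

theorem Between.parent_eq_left (hG : G.IsTree) (h : Between G b w c) (hadj : G.Adj b w) :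
    parent G c b = w := by
  rw [h.symm.parent_eq hG hadj.ne', parent_of_adj hG hadj.symm]

theorem Between.step (hG : G.IsTree) (h : Between G a z t) (hz : z ≠ t) :
    Between G a (parent G t z) t ∧ G.dist a (parent G t z) = G.dist a z + 1 ∧
      parent G a (parent G t z) = z := by
  obtain ⟨hadj, hdist⟩ := parent_spec hG.connected hz.symm
  have htri := hG.connected.dist_triangle (u := a) (v := parent G t z) (w := t)
  have htri' := hG.connected.dist_triangle (u := a) (v := z) (w := parent G t z)
  rw [dist_eq_one_iff_adj.2 hadj.symm] at htri'
  rw [dist_comm, dist_comm (u := t)] at hdist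
  have ha : G.dist a (parent G t z) = G.dist a z + 1 := by omega
  exact ⟨by omega, ha, parent_eq_of_adj hG hadj.symm ha.symm⟩

theorem dist_eq_two_of_adj (hG : G.IsTree) (hx : G.Adj z x) (hy : G.Adj z y) (hxy : x ≠ y) :
    G.dist x y = 2 := by
  have hone := dist_eq_one_iff_adj.2 hx.symm
  have hpos := hG.connected.pos_dist_of_ne hxy
  have := hG.dist_eq_dist_add_one_of_adj x hy
  omega

theorem eq_of_adj_of_adj (hG : G.IsTree) (hxy : x ≠ y) (hwx : G.Adj w x) (hwy : G.Adj w y)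
    (hzx : G.Adj z x) (hzy : G.Adj z y) : w = z := by
  have htwo := dist_eq_two_of_adj hG hwx hwy hxy
  have between {s : V} (hsx : G.Adj s x) (hsy : G.Adj s y) : Between G x s y := by
    rw [Between, dist_eq_one_iff_adj.2 hsx.symm, dist_eq_one_iff_adj.2 hsy, htwo]
  refine (between hwx hwy).eq_of_dist_eq hG (between hzx hzy) ?_
  rw [dist_eq_one_iff_adj.2 hwx.symm, dist_eq_one_iff_adj.2 hzx.symm]

theorem adj_of_dist_eq_two (hG : G.IsTree) (hxy : x ≠ y) (hx : G.Adj z x) (hy : G.Adj z y)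
    (hwx : G.dist w x = 2) (hwy : G.dist w y = 2) : G.Adj w z := by
  rw [← dist_eq_one_iff_adj]
  by_cases h : x = parent G w z
  · have := dist_of_ne_parent hG hy (h ▸ hxy.symm)
    omega
  · have := dist_of_ne_parent hG hx h
    omega

theorem between_of_parent_ne (hG : G.IsTree) (h : parent G a x ≠ parent G t x) :
    Between G a x t := by
  induction hn : G.dist x t generalizing t with
  | zero => simp [hG.connected.dist_eq_zero_iff.1 hn]
  | succ n ih =>
    have hxt : x ≠ t := by
      rintro rfl
      simp at hn
    obtain ⟨hadj, hdist⟩ := parent_spec hG.connected hxt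
    generalize parent G x t = s at hadj hdist
    have hone := dist_eq_one_iff_adj.2 hadj
    by_cases hsx : s = x
    · subst hsx
      rw [parent_of_adj hG hadj.symm] at h
      rw [Between, dist_of_ne_parent hG hadj h.symm, hone]
    · have hbetween : Between G x s t := by omega
      have hs : Between G a x s := ih (hbetween.symm.parent_eq hG hsx ▸ h) (by omega)
      rcases hG.dist_eq_dist_add_one_of_adj a hadj with hst | hst
      · have hparent := parent_eq_of_adj hG hadj.symm hst.symm
        have := dist_parent_add_one hG.connected (Ne.symm hsx)
        rw [← hs.parent_eq hG (Ne.symm hsx), hparent] at this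
        omega
      · omega

theorem Between.parent_eq_of_dist (hG : G.IsTree) (hz : Between G a z t)
    (ha : G.dist a x = G.dist a z + 1) (ht : G.dist x t = G.dist z t + 1) : parent G a x = z := by
  have hparent : parent G a x = parent G t x := by
    by_contra h
    have := between_of_parent_ne hG h
    omega
  have hxa : a ≠ x := by
    rintro rfl
    simp at ha
  have hxt : t ≠ x := by
    rintro rfl
    simp at ht
  have ha' := dist_parent_add_one hG.connected hxa
  have ht' := dist_parent_add_one hG.connected hxt
  rw [← hparent, SimpleGraph.dist_comm, SimpleGraph.dist_comm (u := t)] at ht'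
  exact Between.eq_of_dist_eq hG (a := a) (t := t) (by omega) hz (by omega)

variable [Fintype V]

theorem dist_lt_card (a x : V) : G.dist a x < Fintype.card V := by
  by_cases h : G.dist a x = 0
  · exact h ▸ Fintype.card_pos_iff.2 ⟨a⟩
  · obtain ⟨p, hp, hlength⟩ := (Reachable.of_dist_ne_zero h).exists_path_of_dist
    exact hlength ▸ hp.length_lt

open Classical in
/-- The children of `w` in the graph `G` rooted at `a`. -/
noncomputable def children (G : SimpleGraph V) (a w : V) : Finset V :=
  {x | G.Adj w x ∧ G.dist a x = G.dist a w + 1}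

open Classical in
/-- The vertices of the subtree at `w` of the tree `G` rooted at `a`, that is, the vertices that
`a` reaches through `w`. -/
noncomputable def subtree (G : SimpleGraph V) (a w : V) : Finset V := {c | Between G a w c}

theorem mem_children : x ∈ children G a w ↔ G.Adj w x ∧ G.dist a x = G.dist a w + 1 := by
  simp [children]

theorem mem_subtree : c ∈ subtree G a w ↔ Between G a w c := by simp [subtree]

theorem mem_children_self : x ∈ children G a a ↔ G.Adj a x := by
  simp [mem_children, dist_eq_one_iff_adj]

theorem ne_of_mem_children (hx : x ∈ children G a w) : a ≠ x := by
  rintro rfl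
  simp [mem_children] at hx

theorem parent_of_mem_children (hG : G.IsTree) (hx : x ∈ children G a w) : parent G a x = w :=
  parent_eq_of_adj hG (mem_children.1 hx).1 (mem_children.1 hx).2.symm

theorem mem_children_iff_parent (hG : G.IsTree) :
    x ∈ children G a w ↔ a ≠ x ∧ parent G a x = w := by
  refine ⟨fun hx => ⟨ne_of_mem_children hx, parent_of_mem_children hG hx⟩, ?_⟩
  rintro ⟨h, rfl⟩
  exact mem_children.2 ⟨adj_parent hG.connected h, (dist_parent_add_one hG.connected h).symm⟩

theorem mem_children_iff_ne_parent (hG : G.IsTree) :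
    x ∈ children G a w ↔ G.Adj w x ∧ x ≠ parent G a w := by
  refine ⟨fun hx => ⟨(mem_children.1 hx).1, ?_⟩,
    fun ⟨hadj, hx⟩ => mem_children.2 ⟨hadj, dist_of_ne_parent hG hadj hx⟩⟩
  rintro rfl
  by_cases haw : a = w
  · subst haw
    simp [parent_self, mem_children] at hx
  · have := dist_parent_add_one hG.connected haw
    have := (mem_children.1 hx).2
    omega

theorem children_induction {P : V → Prop} (a : V)
    (h : ∀ w, (∀ x ∈ children G a w, P x) → P w) (w : V) : P w := by
  induction hn : Fintype.card V - G.dist a w using Nat.strong_induction_on generalizing w with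
  | _ n ih =>
    refine h w fun x hx => ih _ ?_ x rfl
    have := dist_lt_card (G := G) a x
    have := (mem_children.1 hx).2
    omega

theorem self_mem_subtree : w ∈ subtree G a w := mem_subtree.2 (by simp [Between])

theorem between_of_mem_subtree_child (hG : G.Connected) (hx : x ∈ children G a w)
    (hc : c ∈ subtree G a x) : Between G a w c ∧ Between G w x c := by
  obtain ⟨hadj, hdist⟩ := mem_children.1 hx
  rw [mem_subtree] at hc
  have hone := dist_eq_one_iff_adj.2 hadj
  have := hG.dist_triangle (u := a) (v := w) (w := c)
  have := hG.dist_triangle (u := w) (v := x) (w := c)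
  exact ⟨by omega, by omega⟩

theorem subtree_subset_erase [DecidableEq V] (hG : G.Connected) (hx : x ∈ children G a w) :
    subtree G a x ⊆ (subtree G a w).erase w := by
  intro c hc
  obtain ⟨hac, hwc⟩ := between_of_mem_subtree_child hG hx hc
  refine Finset.mem_erase.2 ⟨?_, mem_subtree.2 hac⟩
  rintro rfl
  have := dist_eq_one_iff_adj.2 (mem_children.1 hx).1
  simp [Between, this] at hwc

theorem disjoint_subtree (hG : G.IsTree) (hx : x ∈ children G a w) (hy : y ∈ children G a w)
    (hxy : x ≠ y) : Disjoint (subtree G a x) (subtree G a y) := by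
  refine Finset.disjoint_left.2 fun c hcx hcy => hxy ?_
  refine (between_of_mem_subtree_child hG.connected hx hcx).2.eq_of_dist_eq hG
    (between_of_mem_subtree_child hG.connected hy hcy).2 ?_
  rw [dist_eq_one_iff_adj.2 (mem_children.1 hx).1, dist_eq_one_iff_adj.2 (mem_children.1 hy).1]

theorem sum_card_subtree_lt (hG : G.IsTree) (a w : V) :
    ∑ x ∈ children G a w, (subtree G a x).card < (subtree G a w).card := by
  classical
  rw [← Finset.card_biUnion fun x hx y hy hxy => disjoint_subtree hG hx hy hxy]
  refine (Finset.card_le_card (Finset.biUnion_subset.2 fun x hx =>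
    subtree_subset_erase hG.connected hx)).trans_lt (Finset.card_erase_lt_of_mem self_mem_subtree)

/-- A vertex with the smallest sum of distances is a centroid: moving to `x` would bring the
vertices beyond `x` nearer by one and take all the others farther away. -/
theorem exists_centroid (hG : G.IsTree) :
    ∃ z, ∀ x ∈ children G z z, 2 * (subtree G z x).card ≤ Fintype.card V := by
  classical
  have := hG.connected.nonempty
  obtain ⟨z, -, hz⟩ := (Finset.univ : Finset V).exists_min_image (fun z => ∑ c, G.dist z c)
    Finset.univ_nonempty
  refine ⟨z, fun x hx => ?_⟩
  have hzx := mem_children_self.1 hx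
  have hmove (c : V) :
      G.dist x c + (if c ∈ subtree G z x then 2 else 0) = G.dist z c + 1 := by
    have hone := dist_eq_one_iff_adj.2 hzx
    have := hG.dist_eq_dist_add_one_of_adj c hzx
    rw [SimpleGraph.dist_comm, SimpleGraph.dist_comm (u := c)] at this
    split_ifs with hc <;> rw [mem_subtree] at hc <;> omega
  have hsum := Finset.sum_congr rfl fun c (_ : c ∈ (Finset.univ : Finset V)) => hmove c
  simp only [Finset.sum_add_distrib, Finset.sum_ite_mem, Finset.univ_inter, Finset.sum_const,
    Finset.card_univ, smul_eq_mul, mul_one] at hsum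
  have := hz x (Finset.mem_univ x)
  omega

end Tree

/-! ### Types of branches -/

/-- Finite rooted colored trees, which serve as names for the types of the subtrees of a rooted
colored tree. -/
inductive ColoredBranch (C : Type*) where
  | node : C → List (ColoredBranch C) → ColoredBranch C

namespace ColoredBranch

variable {C : Type*}

/-- The number of vertices of a rooted colored tree. -/
def size : ColoredBranch C → ℕ
  | node _ l => 1 + (l.map size).sum

theorem size_node (c : C) (l : List (ColoredBranch C)) :
    (node c l).size = 1 + (l.map size).sum := by
  rw [size]

theorem size_pos (σ : ColoredBranch C) : 0 < σ.size := by
  cases σ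
  rw [size_node]
  omega

end ColoredBranch

open Classical in
/-- The multiset `s` with all multiplicities cut off at `k`: pebble games with `k` pebbles cannot
count further. -/
noncomputable def truncateCount {α : Type*} (k : ℕ) (s : Multiset α) : Multiset α :=
  s ∩ k • s.dedup

open Classical in
theorem count_truncateCount {α : Type*} (k : ℕ) (s : Multiset α) (a : α) :
    (truncateCount k s).count a = min k (s.count a) := by
  rw [truncateCount, Multiset.count_inter, Multiset.count_nsmul, Multiset.count_dedup]
  split_ifs with h
  · rw [mul_one, min_comm]
  · simp [Multiset.count_eq_zero_of_notMem h]

theorem truncateCount_le {α : Type*} (k : ℕ) (s : Multiset α) : truncateCount k s ≤ s := by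
  classical
  exact Multiset.inter_le_left

theorem le_truncateCount {α : Type*} {k : ℕ} {s t : Multiset α} (hst : s ≤ t) (hs : s.card ≤ k) :
    s ≤ truncateCount k t := by
  classical
  refine Multiset.le_iff_count.2 fun a => ?_
  rw [count_truncateCount]
  exact le_min ((s.count_le_card a).trans hs) (Multiset.count_le_of_le a hst)

theorem sum_map_le_sum_map_of_le {α : Type*} {s t : Multiset α} (f : α → ℕ) (h : s ≤ t) :
    (s.map f).sum ≤ (t.map f).sum := by
  obtain ⟨u, rfl⟩ := Multiset.le_iff_exists_add.1 h
  simp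

namespace ColoredGraph

variable {C V W : Type*} [Fintype V] [Fintype W] {k : ℕ} {G : ColoredGraph C V}
  {H : ColoredGraph C W} {a b t w x y z : V} {a' w' : W} {σ : ColoredBranch C}

/-- The type of the subtree at `w` of the tree `G` rooted at `a`: the isomorphism type of the
colored tree that remains when the multiplicity of every type among the children of a vertex is
cut off at `k`, from the leaves upwards. -/
noncomputable def subtreeType (k : ℕ) (G : ColoredGraph C V) (a w : V) : ColoredBranch C :=
  .node (G.color w) (truncateCount k
    ((children G.graph a w).attach.val.map fun x => subtreeType k G a x.1)).toList
termination_by Fintype.card V - G.graph.dist a w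
decreasing_by
  have := dist_lt_card (G := G.graph) a x.1
  have := (mem_children.1 x.2).2
  omega

theorem subtreeType_eq_node (k : ℕ) (G : ColoredGraph C V) (a w : V) :
    G.subtreeType k a w = .node (G.color w)
      (truncateCount k ((children G.graph a w).val.map (G.subtreeType k a))).toList := by
  rw [subtreeType]
  exact congrArg (fun s => ColoredBranch.node (G.color w) (truncateCount k s).toList)
    (Multiset.attach_map_val' _ (G.subtreeType k a))

open Classical in
/-- The number of children of type `σ` of the vertex `w` of the tree `G` rooted at `a`. -/
noncomputable def childCount (k : ℕ) (G : ColoredGraph C V) (a w : V) (σ : ColoredBranch C) : ℕ :=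
  ((children G.graph a w).filter fun x => G.subtreeType k a x = σ).card

open Classical in
theorem count_map_subtreeType (σ : ColoredBranch C) :
    ((children G.graph a w).val.map (G.subtreeType k a)).count σ = G.childCount k a w σ := by
  rw [Multiset.count_map, childCount, Finset.card_def, Finset.filter_val]
  simp_rw [eq_comm]

theorem childCount_pos_iff :
    0 < G.childCount k a w σ ↔ ∃ x ∈ children G.graph a w, G.subtreeType k a x = σ := by
  classical
  simp [childCount, Finset.card_pos, Finset.filter_nonempty_iff]

theorem subtreeType_eq_iff :
    G.subtreeType k a w = H.subtreeType k a' w' ↔ G.color w = H.color w' ∧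
      ∀ σ, min k (G.childCount k a w σ) = min k (H.childCount k a' w' σ) := by
  classical
  rw [subtreeType_eq_node, subtreeType_eq_node, ColoredBranch.node.injEq]
  refine and_congr_right fun _ => ?_
  simp_rw [← count_map_subtreeType, ← count_truncateCount]
  rw [← Multiset.ext]
  refine ⟨fun h => ?_, fun h => by rw [h]⟩
  rw [← Multiset.coe_toList (truncateCount k _), h, Multiset.coe_toList]

theorem subtreeType_congr (hG : G.IsTree) (h : parent G.graph a w = parent G.graph b w) :
    G.subtreeType k a w = G.subtreeType k b w := by
  induction w using children_induction (G := G.graph) a with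
  | h w ih =>
    have hchildren : children G.graph a w = children G.graph b w := by
      ext x
      rw [mem_children_iff_ne_parent hG, mem_children_iff_ne_parent hG, h]
    rw [subtreeType_eq_node, subtreeType_eq_node, ← hchildren]
    congr 3
    refine Multiset.map_congr rfl fun x hx => ih x hx ?_
    rw [parent_of_mem_children hG hx, parent_of_mem_children hG (hchildren ▸ hx)]

theorem subtreeType_of_between (hG : G.IsTree) (h : Between G.graph a z t) (hz : z ≠ t) :
    G.subtreeType k a t = G.subtreeType k z t :=
  subtreeType_congr hG (h.parent_eq hG hz)

theorem subtreeType_of_mem_children (hG : G.IsTree) (hx : x ∈ children G.graph a w) :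
    G.subtreeType k a x = G.subtreeType k w x :=
  subtreeType_congr hG <|
    (parent_of_mem_children hG hx).trans (parent_of_adj hG (mem_children.1 hx).1).symm

open Classical in
theorem childCount_self (hG : G.IsTree) (h : a ≠ z) (σ : ColoredBranch C) :
    G.childCount k z z σ = G.childCount k a z σ +
      if G.subtreeType k z (parent G.graph a z) = σ then 1 else 0 := by
  have hinsert : children G.graph z z = insert (parent G.graph a z) (children G.graph a z) := by
    ext x
    rw [mem_children_self, Finset.mem_insert, mem_children_iff_ne_parent hG]
    by_cases hx : x = parent G.graph a z
    · simp [hx, (adj_parent hG.connected h).symm]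
    · simp [hx]
  have hnotMem : parent G.graph a z ∉ children G.graph a z := fun hmem =>
    ((mem_children_iff_ne_parent hG).1 hmem).2 rfl
  have hfilter : ((children G.graph a z).filter fun x => G.subtreeType k z x = σ).card =
      G.childCount k a z σ :=
    congrArg Finset.card <| Finset.filter_congr fun x hx => by
      rw [subtreeType_of_mem_children hG hx]
  rw [childCount, hinsert, Finset.filter_insert]
  split_ifs
  · rw [Finset.card_insert_of_notMem (by simp [hnotMem]), hfilter]
  · rw [hfilter, add_zero]

theorem size_subtreeType :
    (G.subtreeType k a w).size = 1 + ((truncateCount k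
      ((children G.graph a w).val.map (G.subtreeType k a))).map ColoredBranch.size).sum := by
  rw [subtreeType_eq_node, ColoredBranch.size_node, ← Multiset.sum_coe, ← Multiset.map_coe,
    Multiset.coe_toList]

theorem size_subtreeType_le_card (hG : G.IsTree) (a w : V) :
    (G.subtreeType k a w).size ≤ (subtree G.graph a w).card := by
  induction w using children_induction (G := G.graph) a with
  | h w ih =>
    have htruncate := sum_map_le_sum_map_of_le ColoredBranch.size <|
      truncateCount_le k ((children G.graph a w).val.map (G.subtreeType k a))
    rw [Multiset.map_map] at htruncate
    have hsum := (htruncate.trans (Finset.sum_le_sum ih)).trans_lt (sum_card_subtree_lt hG a w)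
    rw [size_subtreeType]
    omega

theorem sum_size_subtreeType_lt {s : Finset V} (hs : s ⊆ children G.graph a w)
    (hcard : s.card ≤ k) :
    ∑ x ∈ s, (G.subtreeType k a x).size < (G.subtreeType k a w).size := by
  have hle := le_truncateCount
    (Multiset.map_le_map (f := G.subtreeType k a) (Finset.val_le_iff.2 hs))
    ((Multiset.card_map _ _).trans_le hcard)
  have hsum := sum_map_le_sum_map_of_le ColoredBranch.size hle
  rw [Multiset.map_map] at hsum
  rw [size_subtreeType]
  exact Nat.lt_one_add_iff.2 hsum

theorem size_subtreeType_lt (hk : 0 < k) (hx : x ∈ children G.graph a w) :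
    (G.subtreeType k a x).size < (G.subtreeType k a w).size := by
  simpa using sum_size_subtreeType_lt (k := k) (Finset.singleton_subset_iff.2 hx) (by simpa)

theorem size_add_size_lt (hk : 2 ≤ k) (hx : x ∈ children G.graph a w)
    (hy : y ∈ children G.graph a w) (hxy : x ≠ y) :
    (G.subtreeType k a x).size + (G.subtreeType k a y).size < (G.subtreeType k a w).size := by
  classical
  have hs : {x, y} ⊆ children G.graph a w := by simp [Finset.insert_subset_iff, hx, hy]
  have := sum_size_subtreeType_lt hs (Finset.card_le_two.trans hk)
  rwa [Finset.sum_pair hxy] at this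

theorem two_mul_size_lt_of_childCount (hG : G.IsTree) (hk : 2 ≤ k)
    (h : 2 ≤ G.childCount k z z σ) : 2 * σ.size < Fintype.card V := by
  classical
  obtain ⟨x, hx, y, hy, hxy⟩ := Finset.one_lt_card.1 h
  rw [Finset.mem_filter] at hx hy
  have hlt := size_add_size_lt hk hx.1 hy.1 hxy
  have hle := (size_subtreeType_le_card (k := k) hG z z).trans (Finset.card_le_univ _)
  rw [hx.2, hy.2] at hlt
  omega

theorem size_add_dist_le (hG : G.IsTree) (hk : 0 < k) (h : Between G.graph a z t) :
    (G.subtreeType k a t).size + G.graph.dist z t ≤ (G.subtreeType k a z).size := by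
  induction hn : G.graph.dist z t generalizing z with
  | zero => simp [hG.connected.dist_eq_zero_iff.1 hn]
  | succ n ih =>
    have hzt : z ≠ t := by
      rintro rfl
      simp at hn
    obtain ⟨hv, hdist, -⟩ := h.step hG hzt
    have hlt := size_subtreeType_lt hk <|
      mem_children.2 ⟨(adj_parent hG.connected hzt.symm).symm, hdist⟩
    have := ih hv (by omega)
    omega

end ColoredGraph

/-! ### Duplicator's strategy -/

namespace ColoredGraph

variable {C V W : Type*} [Fintype V] [Fintype W] {k : ℕ} {G : ColoredGraph C V}
  {H : ColoredGraph C W} {z s y : V} {z' s' : W} {R : Set (V × W)}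

/-- `R` is a type-preserving partial isomorphism between the trees `G` and `H` with roots `z` and
`z'` whose domain and range are closed under taking parents. It is encoded as a relation, so that
it can be reversed, and as the root is its own parent, no case distinction is needed for it. -/
structure IsTypeMatching (k : ℕ) (G : ColoredGraph C V) (H : ColoredGraph C W) (z : V) (z' : W)
    (R : Set (V × W)) : Prop where
  root_mem : (z, z') ∈ R
  eq_iff : ∀ p ∈ R, ∀ q ∈ R, p.1 = q.1 ↔ p.2 = q.2
  type_eq : ∀ p ∈ R, G.subtreeType k z p.1 = H.subtreeType k z' p.2
  parent_mem : ∀ p ∈ R, (parent G.graph z p.1, parent H.graph z' p.2) ∈ R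

namespace IsTypeMatching

theorem singleton (h : G.subtreeType k z z = H.subtreeType k z' z') :
    IsTypeMatching k G H z z' {(z, z')} where
  root_mem := rfl
  eq_iff := by simp
  type_eq := by simpa using h
  parent_mem := by simp [parent_self]

theorem swap (h : IsTypeMatching k G H z z' R) :
    IsTypeMatching k H G z' z (Prod.swap ⁻¹' R) where
  root_mem := h.root_mem
  eq_iff _ hp _ hq := (h.eq_iff _ hp _ hq).symm
  type_eq _ hp := (h.type_eq _ hp).symm
  parent_mem _ hp := h.parent_mem _ hp

theorem color_eq (h : IsTypeMatching k G H z z' R) {p : V × W} (hp : p ∈ R) :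
    G.color p.1 = H.color p.2 :=
  (subtreeType_eq_iff.1 (h.type_eq p hp)).1

theorem mem_children_iff (h : IsTypeMatching k G H z z' R) (hG : G.IsTree) (hH : H.IsTree)
    {p q : V × W} (hp : p ∈ R) (hq : q ∈ R) :
    q.1 ∈ children G.graph z p.1 ↔ q.2 ∈ children H.graph z' p.2 := by
  rw [mem_children_iff_parent hG, mem_children_iff_parent hH]
  exact and_congr (h.eq_iff _ h.root_mem q hq).not (h.eq_iff _ (h.parent_mem q hq) p hp)

theorem adj_iff (h : IsTypeMatching k G H z z' R) (hG : G.IsTree) (hH : H.IsTree)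
    {p q : V × W} (hp : p ∈ R) (hq : q ∈ R) :
    G.graph.Adj p.1 q.1 ↔ H.graph.Adj p.2 q.2 := by
  rw [adj_iff_parent hG z, adj_iff_parent hH z']
  exact or_congr
    (and_congr (h.eq_iff p hp _ h.root_mem).not (h.eq_iff _ (h.parent_mem p hp) q hq))
    (and_congr (h.eq_iff q hq _ h.root_mem).not (h.eq_iff _ (h.parent_mem q hq) p hp))

open Classical in
theorem exists_fresh_child (h : IsTypeMatching k G H z z' R) (hG : G.IsTree) (hH : H.IsTree)
    (hs : (s, s') ∈ R) (hy : y ∈ children G.graph z s) (hyR : y ∉ Prod.fst '' R)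
    (hcard : ((children G.graph z s).filter (· ∈ Prod.fst '' R)).card < k) :
    ∃ y' ∈ children H.graph z' s', H.subtreeType k z' y' = G.subtreeType k z y ∧
      y' ∉ Prod.snd '' R := by
  set σ := G.subtreeType k z y
  let A := (children G.graph z s).filter fun x => G.subtreeType k z x = σ ∧ x ∈ Prod.fst '' R
  let A' := (children H.graph z' s').filter fun x' =>
    H.subtreeType k z' x' = σ ∧ x' ∈ Prod.snd '' R
  have hA'A : A'.card ≤ A.card := by
    have hmatch : ∀ x' ∈ A', ∃ x ∈ A, (x, x') ∈ R := by
      intro x' hx'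
      obtain ⟨hchild, htype, ⟨x, _⟩, hx, rfl⟩ := Finset.mem_filter.1 hx'
      exact ⟨x, Finset.mem_filter.2 ⟨(h.mem_children_iff hG hH hs hx).2 hchild,
        (h.type_eq _ hx).trans htype, _, hx, rfl⟩, hx⟩
    have : Nonempty V := ⟨z⟩
    choose! f hfA hfR using hmatch
    exact Finset.card_le_card_of_injOn f hfA fun x' hx' y' hy' hxy =>
      (h.eq_iff _ (hfR x' hx') _ (hfR y' hy')).1 hxy
  have hAk : A.card < k := hcard.trans_le' <| Finset.card_le_card fun x hx => by
    rw [Finset.mem_filter] at hx ⊢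
    exact ⟨hx.1, hx.2.2⟩
  have hAcount : A.card < G.childCount k z s σ := by
    refine Finset.card_lt_card (Finset.ssubset_iff_of_subset (fun x hx => ?_) |>.2
      ⟨y, Finset.mem_filter.2 ⟨hy, rfl⟩, fun hyA => hyR (Finset.mem_filter.1 hyA).2.2⟩)
    rw [Finset.mem_filter] at hx ⊢
    exact ⟨hx.1, hx.2.1⟩
  have hcount : min k (G.childCount k z s σ) = min k (H.childCount k z' s' σ) :=
    (subtreeType_eq_iff.1 (h.type_eq _ hs)).2 σ
  obtain ⟨y', hy', hyA'⟩ := Finset.exists_mem_notMem_of_card_lt_card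
    (show A'.card < H.childCount k z' s' σ by omega)
  obtain ⟨hchild, htype⟩ := Finset.mem_filter.1 hy'
  exact ⟨y', hchild, htype, fun hmem => hyA' (Finset.mem_filter.2 ⟨hchild, htype, hmem⟩)⟩

theorem insert_child (h : IsTypeMatching k G H z z' R) (hG : G.IsTree) (hH : H.IsTree) {y' : W}
    (hs : (s, s') ∈ R) (hy : y ∈ children G.graph z s) (hy' : y' ∈ children H.graph z' s')
    (htype : G.subtreeType k z y = H.subtreeType k z' y') (hyR : y ∉ Prod.fst '' R)
    (hyR' : y' ∉ Prod.snd '' R) : IsTypeMatching k G H z z' (insert (y, y') R) where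
  root_mem := .inr h.root_mem
  eq_iff := by
    have hne : ∀ p ∈ R, p.1 ≠ y ∧ p.2 ≠ y' := fun p hp =>
      ⟨fun hpy => hyR ⟨p, hp, hpy⟩, fun hpy => hyR' ⟨p, hp, hpy⟩⟩
    rintro p (rfl | hp) q (rfl | hq)
    · simp
    · simp [(hne q hq).1.symm, (hne q hq).2.symm]
    · simp [hne p hp]
    · exact h.eq_iff p hp q hq
  type_eq := by
    rintro p (rfl | hp)
    exacts [htype, h.type_eq p hp]
  parent_mem := by
    rintro p (rfl | hp)
    · right
      rwa [parent_of_mem_children hG hy, parent_of_mem_children hH hy']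
    · exact .inr (h.parent_mem p hp)

open Classical in
theorem exists_extension (h : IsTypeMatching k G H z z' R) (hG : G.IsTree) (hH : H.IsTree)
    (hcard : ∀ s, ((children G.graph z s).filter (· ∈ Prod.fst '' R)).card < k) (y : V) :
    ∃ T y', IsTypeMatching k G H z z' T ∧ R ⊆ T ∧ (y, y') ∈ T ∧
      ∀ p ∈ T, p ∈ R ∨ G.graph.dist z p.1 ≤ G.graph.dist z y := by
  induction hn : G.graph.dist z y generalizing y with
  | zero =>
    obtain rfl := hG.connected.dist_eq_zero_iff.1 hn
    exact ⟨R, z', h, subset_rfl, h.root_mem, fun p hp => .inl hp⟩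
  | succ n ih =>
    have hzy : z ≠ y := by
      rintro rfl
      simp at hn
    have hdist := dist_parent_add_one hG.connected hzy
    obtain ⟨T, s', hT, hRT, hs, hnew⟩ := ih (parent G.graph z y) (by omega)
    by_cases hy : y ∈ Prod.fst '' T
    · obtain ⟨⟨_, y'⟩, hyT, rfl⟩ := hy
      exact ⟨T, y', hT, hRT, hyT, fun p hp => (hnew p hp).imp_right (by omega)⟩
    have hchild : y ∈ children G.graph z (parent G.graph z y) :=
      (mem_children_iff_parent hG).2 ⟨hzy, rfl⟩
    obtain ⟨y', hchild', htype, hy'⟩ := hT.exists_fresh_child hG hH hs hchild hy <| by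
      refine (hcard (parent G.graph z y)).trans_le' (Finset.card_le_card fun x hx => ?_)
      obtain ⟨hx, p, hp, rfl⟩ := Finset.mem_filter.1 hx
      refine Finset.mem_filter.2 ⟨hx, p, (hnew p hp).resolve_right ?_, rfl⟩
      have := (mem_children.1 hx).2
      omega
    refine ⟨insert (y, y') T, y', hT.insert_child hG hH hs hchild hchild' htype.symm hy hy',
      hRT.trans (Set.subset_insert _ _), .inl rfl, ?_⟩
    rintro p (rfl | hp)
    exacts [.inr hn.le, (hnew p hp).imp_right (by omega)]

theorem restrict (h : IsTypeMatching k G H z z' R) (hG : G.IsTree) (S : Set V) :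
    IsTypeMatching k G H z z' {p ∈ R | p.1 = z ∨ ∃ t ∈ S, t ∈ subtree G.graph z p.1} where
  root_mem := ⟨h.root_mem, .inl rfl⟩
  eq_iff p hp q hq := h.eq_iff p hp.1 q hq.1
  type_eq p hp := h.type_eq p hp.1
  parent_mem p hp := by
    refine ⟨h.parent_mem p hp.1, ?_⟩
    by_cases hz : z = p.1
    · exact .inl (by rw [← hz, parent_self])
    · obtain ⟨t, htS, ht⟩ := hp.2.resolve_left (Ne.symm hz)
      have hchild : p.1 ∈ children G.graph z (parent G.graph z p.1) :=
        (mem_children_iff_parent hG).2 ⟨hz, rfl⟩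
      classical
      exact .inr ⟨t, htS,
        Finset.mem_of_mem_erase (subtree_subset_erase hG.connected hchild ht)⟩

open Classical in
theorem card_filter_children_le (hG : G.IsTree) (z s : V) (S : Finset V) :
    ((children G.graph z s).filter fun x => ∃ t ∈ S, t ∈ subtree G.graph z x).card ≤ S.card := by
  have hwitness : ∀ x ∈ (children G.graph z s).filter fun x => ∃ t ∈ S, t ∈ subtree G.graph z x,
      ∃ t ∈ S, t ∈ subtree G.graph z x := fun x hx => (Finset.mem_filter.1 hx).2
  choose! f hfS hf using hwitness
  refine Finset.card_le_card_of_injOn f hfS fun x hx y hy hxy => ?_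
  by_contra hne
  refine Finset.disjoint_left.1 (disjoint_subtree hG (Finset.mem_filter.1 hx).1
    (Finset.mem_filter.1 hy).1 hne) (hf x hx) ?_
  rw [hxy]
  exact hf y hy

open Classical in
theorem exists_update (h : IsTypeMatching k G H z z' R) (hG : G.IsTree) (hH : H.IsTree)
    {p : Fin k → V} {q : Fin k → W} (hpq : ∀ j, (p j, q j) ∈ R) (i : Fin k) (x : V) :
    ∃ x' T, IsTypeMatching k G H z z' T ∧
      ∀ j, (Function.update p i x j, Function.update q i x' j) ∈ T := by
  let S := (Finset.univ.erase i).image p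
  have hS : S.card < k := by
    refine Finset.card_image_le.trans_lt ?_
    rw [Finset.card_erase_of_mem (Finset.mem_univ i), Finset.card_univ, Fintype.card_fin]
    exact Nat.sub_lt i.pos one_pos
  obtain ⟨T, x', hT, hRT, hx, -⟩ := (h.restrict hG ↑S).exists_extension hG hH (fun s => by
    refine hS.trans_le' ((card_filter_children_le hG z s S).trans' (Finset.card_le_card ?_))
    intro y hy
    obtain ⟨hy, r, hr, rfl⟩ := Finset.mem_filter.1 hy
    exact Finset.mem_filter.2 ⟨hy, hr.2.resolve_left (ne_of_mem_children hy).symm⟩) x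
  refine ⟨x', T, hT, fun j => ?_⟩
  by_cases hj : j = i
  · subst hj
    simpa using hx
  · rw [Function.update_of_ne hj, Function.update_of_ne hj]
    exact hRT ⟨hpq j, .inr ⟨p j, Finset.mem_image_of_mem p (by simpa using hj),
      self_mem_subtree⟩⟩

theorem isBackAndForth (hG : G.IsTree) (hH : H.IsTree) (z : V) (z' : W) :
    FOk.IsBackAndForth G H fun (p : Fin k → V) q =>
      ∃ R, IsTypeMatching k G H z z' R ∧ ∀ i, (p i, q i) ∈ R where
  eq_iff := fun ⟨_, h, hpq⟩ i j => h.eq_iff _ (hpq i) _ (hpq j)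
  adj_iff := fun ⟨_, h, hpq⟩ i j => h.adj_iff hG hH (hpq i) (hpq j)
  color_eq := fun ⟨_, h, hpq⟩ i => h.color_eq (hpq i)
  forth := fun ⟨_, h, hpq⟩ i x =>
    let ⟨x', T, hT, hmem⟩ := h.exists_update hG hH hpq i x
    ⟨x', T, hT, hmem⟩
  back := fun ⟨_, h, hpq⟩ i x' =>
    let ⟨x, _, hT, hmem⟩ := h.swap.exists_update hH hG hpq i x'
    ⟨x, _, hT.swap, hmem⟩

end IsTypeMatching

theorem not_distinguishes (hG : G.IsTree) (hH : H.IsTree)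
    (h : G.subtreeType k z z = H.subtreeType k z' z') (φ : FOk C k) : ¬ φ.Distinguishes G H := by
  rintro ⟨hsentence, hGφ, hHφ⟩
  refine hHφ fun q => ?_
  have hroot := (IsTypeMatching.isBackAndForth hG hH z z').sat_iff φ (p := fun _ => z)
    (q := fun _ => z') ⟨_, .singleton h, fun _ => rfl⟩
  exact (φ.sat_congr (by simp [show φ.freeVars = ∅ from hsentence])).1 (hroot.1 (hGφ _))

end ColoredGraph

/-! ### Distances and neighborhoods in the game -/

namespace SpoilerWins

variable {C V W : Type*} {k r : ℕ} {G : ColoredGraph C V} {H : ColoredGraph C W}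
  {L Q : List (V × W)} {a x y z : V} {a' x' y' z' : W}

theorem of_dist_lt [Finite W] (hk : 3 ≤ k) (hG : G.graph.Connected) (hH : H.graph.Connected)
    (hx : (x, x') ∈ L) (hy : (y, y') ∈ L) (hr : G.graph.dist x y ≤ 2 ^ r)
    (h : G.graph.dist x y < H.graph.dist x' y') : SpoilerWins k G H r L := by
  have := hH.nonempty
  induction r generalizing x y x' y' L with
  | zero =>
    rcases Nat.eq_zero_or_pos (G.graph.dist x y) with hzero | hpos
    · refine .of_eq hx hy ?_
      rw [← hG.dist_eq_zero_iff, ← hH.dist_eq_zero_iff]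
      omega
    · refine .of_adj hx hy ?_
      rw [← SimpleGraph.dist_eq_one_iff_adj, ← SimpleGraph.dist_eq_one_iff_adj]
      omega
  | succ r ih =>
    obtain ⟨z, hz, hdist⟩ := exists_between_of_le_dist hG (min_le_right (2 ^ r) (G.graph.dist x y))
    refine mono (L := [(x, x'), (y, y')]) (step hk z fun z' => ?_) le_rfl (by simp [hx, hy])
    have htri := hH.dist_triangle (u := x') (v := z') (w := y')
    rw [pow_succ] at hr
    rcases lt_or_ge (G.graph.dist x z) (H.graph.dist x' z') with hlt | hge
    · exact ih (x := x) (y := z) (x' := x') (y' := z') (by simp) (by simp) (by omega) hlt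
    · exact ih (x := z) (y := y) (x' := z') (y' := y') (by simp) (by simp) (by omega) (by omega)

theorem of_dist_ne [Finite V] [Finite W] (hk : 3 ≤ k) (hG : G.graph.Connected)
    (hH : H.graph.Connected) (hx : (x, x') ∈ L) (hy : (y, y') ∈ L)
    (hr : G.graph.dist x y ≤ 2 ^ r) (h : G.graph.dist x y ≠ H.graph.dist x' y') :
    SpoilerWins k G H r L := by
  rcases h.lt_or_gt with hlt | hgt
  · exact of_dist_lt hk hG hH hx hy hr hlt
  · exact of_swap <| of_dist_lt hk hH hG (List.mem_map_of_mem hx) (List.mem_map_of_mem hy)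
      (hgt.le.trans hr) hgt

theorem of_parent [Finite V] [Finite W] (hk : 3 ≤ k) (hG : G.IsTree) (hH : H.IsTree)
    (ha : (a, a') ∈ L) (hz : (z, z') ∈ L) (haz : a ≠ z)
    (hdist : G.graph.dist a z = H.graph.dist a' z') (hr : G.graph.dist a z ≤ 2 ^ r)
    (h : SpoilerWins k G H r [(z, z'), (parent G.graph a z, parent H.graph a' z')]) :
    SpoilerWins k G H (r + 1) L := by
  have := hH.connected.nonempty
  have hparent := dist_parent_add_one hG.connected haz
  refine mono (L := [(z, z'), (a, a')])
    (step hk (parent G.graph a z) fun u' => ?_) le_rfl (by simp [ha, hz])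
  by_cases hadj : H.graph.Adj u' z'
  · by_cases hu' : G.graph.dist a (parent G.graph a z) = H.graph.dist a' u'
    · rw [parent_eq_of_adj hH hadj (by omega)] at h
      exact h.mono le_rfl (by simp)
    · exact of_dist_ne hk hG.connected hH.connected (x := a) (x' := a')
        (y := parent G.graph a z) (y' := u') (by simp) (by simp) (by omega) hu'
  · exact of_adj (x := parent G.graph a z) (x' := u') (y := z) (y' := z') (by simp) (by simp)
      (by simp [adj_parent hG.connected haz, hadj])

theorem of_return_to_center [Finite W] (hk : 3 ≤ k) (hH : H.IsTree) (hxy : x' ≠ y')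
    (hx : G.graph.Adj z x) (hy : G.graph.Adj z y) (hx' : H.graph.Adj z' x')
    (hy' : H.graph.Adj z' y') (h : SpoilerWins k G H r [(z, z'), (x, x')]) :
    SpoilerWins k G H (r + 1) [(x, x'), (y, y')] := by
  have := hH.connected.nonempty
  refine step hk z fun w' => ?_
  by_cases hwx : H.graph.Adj w' x'
  · by_cases hwy : H.graph.Adj w' y'
    · rw [eq_of_adj_of_adj hH hxy hx' hy' hwx hwy] at h
      exact h.mono le_rfl (by simp)
    · exact of_adj (x := z) (x' := w') (y := y) (y' := y') (by simp) (by simp) (by simp [hy, hwy])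
  · exact of_adj (x := z) (x' := w') (y := x) (y' := x') (by simp) (by simp) (by simp [hx, hwx])

/-- Two pebbles on neighbors of `z` fix the position of `z`, so the pebble on `z` may be lifted in
order to pebble one more neighbor. -/
theorem of_neighbor_without_center [Finite V] [Finite W] (hk : 3 ≤ k) (hG : G.IsTree)
    (hH : H.IsTree)
    (hQ : ∀ q ∈ Q, G.graph.Adj z q.1 ∧ H.graph.Adj z' q.2) (hnodup : (Q.map Prod.snd).Nodup)
    (hQ₂ : 2 ≤ Q.length) (hQk : Q.length < k) (hy : G.graph.Adj z y) (hyQ : ∀ q ∈ Q, q.1 ≠ y)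
    (h : ∀ y', H.graph.Adj z' y' → y' ∉ Q.map Prod.snd → SpoilerWins k G H r [(z, z'), (y, y')]) :
    SpoilerWins k G H (r + 2) Q := by
  have := hH.connected.nonempty
  obtain ⟨q₁, q₂, Q', rfl⟩ : ∃ q₁ q₂ Q', Q = q₁ :: q₂ :: Q' := by
    match Q, hQ₂ with
    | q₁ :: q₂ :: Q', _ => exact ⟨q₁, q₂, Q', rfl⟩
  obtain ⟨hq₁, hq₁'⟩ := hQ q₁ (by simp)
  obtain ⟨-, hq₂'⟩ := hQ q₂ (by simp)
  have hq : q₁.2 ≠ q₂.2 := by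
    rintro heq
    simp [heq] at hnodup
  refine step hQk y fun y' => ?_
  by_cases hfresh : y' ∈ (q₁ :: q₂ :: Q').map Prod.snd
  · obtain ⟨q, hqQ, rfl⟩ := List.mem_map.1 hfresh
    exact of_eq (x := y) (x' := q.2) (y := q.1) (y' := q.2) (by simp) (.tail _ hqQ)
      (by simp [(hyQ q hqQ).symm])
  by_cases hfar : ∃ q ∈ q₁ :: q₂ :: Q', H.graph.dist y' q.2 ≠ 2
  · obtain ⟨q, hqQ, hdist⟩ := hfar
    have htwo := dist_eq_two_of_adj hG hy (hQ q hqQ).1 (hyQ q hqQ).symm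
    exact of_dist_ne hk hG.connected hH.connected (x := y) (x' := y') (y := q.1) (y' := q.2)
      (by simp) (.tail _ hqQ) (htwo.trans_le (Nat.le_self_pow r.succ_ne_zero 2))
      (by rw [htwo]; exact hdist.symm)
  push Not at hfar
  have hy' : H.graph.Adj z' y' := (adj_of_dist_eq_two hH hq hq₁' hq₂' (hfar q₁ (by simp))
    (hfar q₂ (by simp))).symm
  have hne : y' ≠ q₁.2 := fun heq => hfresh (by simp [heq])
  exact (of_return_to_center hk hH hne hy hq₁ hy' hq₁'
    (h y' hy' hfresh)).mono le_rfl (by simp)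

theorem of_neighbor_response (hz : (z, z') ∈ L) (hy : (y, y') ∈ L) (hQL : Q ⊆ L)
    (hadj : G.graph.Adj z y) (hyQ : ∀ q ∈ Q, q.1 ≠ y)
    (h : H.graph.Adj z' y' → y' ∉ Q.map Prod.snd → SpoilerWins k G H r L) :
    SpoilerWins k G H r L := by
  by_cases hfresh : y' ∈ Q.map Prod.snd
  · obtain ⟨q, hqQ, rfl⟩ := List.mem_map.1 hfresh
    exact of_eq hy (hQL hqQ) (by simp [(hyQ q hqQ).symm])
  by_cases hy' : H.graph.Adj z' y'
  · exact h hy' hfresh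
  · exact of_adj hz hy (by simp [hadj, hy'])

theorem of_card_lt [Finite V] [Finite W] {D : Finset V} {E : Finset W}
    (hk : 3 ≤ k) (hG : G.IsTree) (hH : H.IsTree)
    (hQ : ∀ q ∈ Q, G.graph.Adj z q.1 ∧ H.graph.Adj z' q.2) (hnodup : (Q.map Prod.snd).Nodup)
    (hD : ∀ y ∈ D, G.graph.Adj z y) (hQD : ∀ q ∈ Q, q.1 ∉ D) (hcard : E.card < D.card)
    (hlength : Q.length + E.card + 1 ≤ k)
    (h : ∀ y ∈ D, ∀ y', H.graph.Adj z' y' → y' ∉ Q.map Prod.snd → y' ∉ E →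
      SpoilerWins k G H r [(z, z'), (y, y')]) :
    SpoilerWins k G H (r + E.card + 2) ((z, z') :: Q) := by
  classical
  have := hH.connected.nonempty
  induction E using Finset.strongInduction generalizing Q D with
  | H E ih =>
    obtain ⟨y, hy⟩ := Finset.card_pos.1 (Nat.zero_lt_of_lt hcard)
    have hyQ : ∀ q ∈ Q, q.1 ≠ y := by
      rintro q hq rfl
      exact hQD q hq hy
    rcases lt_or_ge (Q.length + 1) k with hroom | hfull
    · refine step (r := r + E.card + 1) hroom y fun y' => ?_
      refine of_neighbor_response (z := z) (z' := z') (y := y) (y' := y') (Q := Q) (by simp)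
        (by simp) (fun q hq => .tail _ (.tail _ hq)) (hD y hy) hyQ fun hy' hfresh => ?_
      by_cases hyE : y' ∈ E
      swap
      · exact (h y hy y' hy' hfresh hyE).mono (by omega) (by simp)
      have hE := Finset.card_erase_add_one hyE
      have hDy := Finset.card_erase_add_one hy
      refine (ih (E.erase y') (Finset.erase_ssubset hyE) (Q := (y, y') :: Q) (D := D.erase y)
        (List.forall_mem_cons.2 ⟨⟨hD y hy, hy'⟩, hQ⟩) (List.nodup_cons.2 ⟨hfresh, hnodup⟩)
        (fun w hw => hD w (Finset.mem_of_mem_erase hw))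
        (List.forall_mem_cons.2 ⟨Finset.notMem_erase y D,
          fun q hq hmem => hQD q hq (Finset.mem_of_mem_erase hmem)⟩) (by omega)
        (by rw [List.length_cons]; omega) fun w hw w' hw' hwQ hwE => ?_).mono
        (by omega) (by simp)
      rw [List.map_cons, List.mem_cons, not_or] at hwQ
      exact h w (Finset.mem_of_mem_erase hw) w' hw' hwQ.2 fun hmem =>
        hwE (Finset.mem_erase.2 ⟨hwQ.1, hmem⟩)
    · obtain rfl : E = ∅ := Finset.card_eq_zero.1 (by omega)
      exact (of_neighbor_without_center hk hG hH hQ hnodup (by omega) (by omega) (hD y hy) hyQ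
        fun y' hy' hfresh => h y hy y' hy' hfresh (Finset.notMem_empty _)).mono (by simp) (by simp)

end SpoilerWins

/-! ### Spoiler's strategy on branches -/

namespace ColoredGraph

variable {C V W : Type*} [Fintype V] [Fintype W] {k m n r s : ℕ} {G : ColoredGraph C V}
  {H : ColoredGraph C W} {L Q : List (V × W)} {a z : V} {a' z' : W} {σ : ColoredBranch C}

theorem spoilerWins_of_childCount_lt (hk : 3 ≤ k) (hG : G.IsTree) (hH : H.IsTree)
    (hQ : ∀ q ∈ Q, G.graph.Adj z q.1 ∧ H.graph.Adj z' q.2) (hnodup : (Q.map Prod.snd).Nodup)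
    (hQ_left : ∀ q ∈ Q, q.1 ∉ children G.graph a z)
    (hQ_right : ∀ x', H.graph.Adj z' x' → x' ∉ Q.map Prod.snd → x' ∈ children H.graph a' z')
    (hlt : H.childCount k a' z' σ < G.childCount k a z σ)
    (hlength : Q.length + H.childCount k a' z' σ + 1 ≤ k)
    (h : ∀ x ∈ children G.graph a z, ∀ x' ∈ children H.graph a' z', G.subtreeType k z x = σ →
      H.subtreeType k z' x' ≠ σ → SpoilerWins k G H r [(z, z'), (x, x')]) :
    SpoilerWins k G H (r + H.childCount k a' z' σ + 2) ((z, z') :: Q) := by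
  classical
  refine .of_card_lt hk hG hH hQ hnodup (fun y hy => ?_) (fun q hq hmem => ?_) hlt hlength
    fun y hy y' hadj hyQ hyE => ?_
  · exact (mem_children.1 (Finset.mem_filter.1 hy).1).1
  · exact hQ_left q hq (Finset.mem_filter.1 hmem).1
  · obtain ⟨hy, htype⟩ := Finset.mem_filter.1 hy
    have hy' := hQ_right y' hadj hyQ
    refine h y hy y' hy' (by rwa [← subtreeType_of_mem_children hG hy]) fun htype' =>
      hyE (Finset.mem_filter.2 ⟨hy', ?_⟩)
    rwa [subtreeType_of_mem_children hH hy']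

theorem spoilerWins_of_childCount_parent_lt (hk : 3 ≤ k) (hG : G.IsTree) (hH : H.IsTree)
    (haz : a ≠ z) (haz' : a' ≠ z') (hlt : H.childCount k a' z' σ < G.childCount k a z σ)
    (hcount : H.childCount k a' z' σ + 2 ≤ k)
    (h : ∀ x ∈ children G.graph a z, ∀ x' ∈ children H.graph a' z', G.subtreeType k z x = σ →
      H.subtreeType k z' x' ≠ σ → SpoilerWins k G H r [(z, z'), (x, x')]) :
    SpoilerWins k G H (r + k) [(z, z'), (parent G.graph a z, parent H.graph a' z')] := by
  refine (spoilerWins_of_childCount_lt (Q := [(parent G.graph a z, parent H.graph a' z')])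
    hk hG hH ?_ ?_ ?_ ?_ hlt ?_ h).mono (by omega) (List.Subset.refl _)
  · simp [(adj_parent hG.connected haz).symm, (adj_parent hH.connected haz').symm]
  · simp
  · simp [mem_children_iff_ne_parent hG]
  · simp +contextual [mem_children_iff_ne_parent hH]
  · rw [List.length_singleton]
    omega

theorem spoilerWins_of_childCount_self_lt (hk : 3 ≤ k) (hG : G.IsTree) (hH : H.IsTree)
    (hlt : H.childCount k z' z' σ < G.childCount k z z σ) (hcount : H.childCount k z' z' σ < k)
    (h : ∀ x ∈ children G.graph z z, ∀ x' ∈ children H.graph z' z', G.subtreeType k z x = σ →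
      H.subtreeType k z' x' ≠ σ → SpoilerWins k G H r [(z, z'), (x, x')]) :
    SpoilerWins k G H (r + H.childCount k z' z' σ + 2) [(z, z')] := by
  refine spoilerWins_of_childCount_lt hk hG hH ?_ ?_ ?_ ?_ hlt ?_ h
  · simp
  · simp
  · simp
  · simp [mem_children_self]
  · rw [List.length_nil]
    omega

/-- Spoiler wins in `r` rounds from all positions in which the second vertices of two pebbled edges
are the roots of branches of different types, one of which has size at most `m`. -/
def BranchWins (k : ℕ) (G : ColoredGraph C V) (H : ColoredGraph C W) (m r : ℕ) : Prop :=
  ∀ ⦃b w b' w'⦄, G.graph.Adj b w → H.graph.Adj b' w' →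
    G.subtreeType k b w ≠ H.subtreeType k b' w' →
    (G.subtreeType k b w).size ≤ m ∨ (H.subtreeType k b' w').size ≤ m →
    SpoilerWins k G H r [(b, b'), (w, w')]

namespace BranchWins

theorem mono (h : BranchWins k G H m r) (hn : n ≤ m) (hrs : r ≤ s) : BranchWins k G H n s :=
  fun _ _ _ _ hadj hadj' hne hsize =>
    (h hadj hadj' hne (hsize.imp hn.trans' hn.trans')).mono hrs (List.Subset.refl _)

theorem swap (h : BranchWins k G H m r) : BranchWins k H G m r :=
  fun _ _ _ _ hadj hadj' hne hsize => (h hadj' hadj hne.symm hsize.symm).swap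

theorem of_mem_children (h : BranchWins k G H m r) {x : V} {x' : W}
    (hx : x ∈ children G.graph a z) (hx' : x' ∈ children H.graph a' z')
    (hne : G.subtreeType k z x ≠ H.subtreeType k z' x')
    (hsize : (G.subtreeType k z x).size ≤ m ∨ (H.subtreeType k z' x').size ≤ m) :
    SpoilerWins k G H r [(z, z'), (x, x')] :=
  h (mem_children.1 hx).1 (mem_children.1 hx').1 hne hsize

theorem spoilerWins_of_childCount_parent_ne (hB : BranchWins k G H m r) (hk : 3 ≤ k)
    (hG : G.IsTree) (hH : H.IsTree) (haz : a ≠ z) (haz' : a' ≠ z')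
    (hne : G.childCount k a z σ ≠ H.childCount k a' z' σ)
    (hcount : min (G.childCount k a z σ) (H.childCount k a' z' σ) + 2 ≤ k)
    (hgt : H.childCount k a' z' σ < G.childCount k a z σ → σ.size ≤ m)
    (hlt : G.childCount k a z σ < H.childCount k a' z' σ → ∀ x ∈ children G.graph a z,
      G.subtreeType k z x ≠ σ → (G.subtreeType k z x).size ≤ m ∨ σ.size ≤ m) :
    SpoilerWins k G H (r + k) [(z, z'), (parent G.graph a z, parent H.graph a' z')] := by
  rcases hne.lt_or_gt with h | h
  · rw [min_eq_left h.le] at hcount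
    refine .of_swap <| spoilerWins_of_childCount_parent_lt hk hH hG haz' haz h hcount
      fun x' hx' x hx hσ' hσ => hB.swap.of_mem_children hx' hx (hσ' ▸ hσ.symm) ?_
    rw [hσ']
    exact (hlt h x hx hσ).symm
  · refine spoilerWins_of_childCount_parent_lt hk hG hH haz haz' h (by omega)
      fun x hx x' hx' hσ hσ' => hB.of_mem_children hx hx' (hσ ▸ hσ'.symm) (.inl ?_)
    rw [hσ]
    exact hgt h

theorem spoilerWins_of_childCount_self_ne (hB : BranchWins k G H m r) (hk : 3 ≤ k)
    (hG : G.IsTree) (hH : H.IsTree)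
    (hne : min k (G.childCount k z z σ) ≠ min k (H.childCount k z' z' σ))
    (hsize : ∀ x ∈ children G.graph z z, (G.subtreeType k z x).size ≤ m ∨ σ.size ≤ m) :
    SpoilerWins k G H (r + min (G.childCount k z z σ) (H.childCount k z' z' σ) + 2)
      [(z, z')] := by
  rcases lt_trichotomy (G.childCount k z z σ) (H.childCount k z' z' σ) with h | h | h
  · rw [min_eq_left h.le]
    refine .of_swap <| spoilerWins_of_childCount_self_lt hk hH hG h (by omega)
      fun x' hx' x hx hσ' hσ => hB.swap.of_mem_children hx' hx (hσ' ▸ hσ.symm) ?_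
    rw [hσ']
    exact (hsize x hx).symm
  · exact (hne (by rw [h])).elim
  · rw [min_eq_right h.le]
    refine spoilerWins_of_childCount_self_lt hk hG hH h (by omega)
      fun x hx x' hx' hσ hσ' => hB.of_mem_children hx hx' (hσ ▸ hσ'.symm) (.inl ?_)
    rw [hσ]
    simpa only [hσ, or_self] using hsize x hx

theorem spoilerWins_of_childCount_ne_of_size_le (hB : BranchWins k G H m r) (hk : 3 ≤ k)
    (hG : G.IsTree) (hH : H.IsTree) (haz : a ≠ z) (haz' : a' ≠ z')
    (hne : min k (G.childCount k a z σ) ≠ min k (H.childCount k a' z' σ)) (hsize : σ.size ≤ m)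
    (hparent : ¬ (G.subtreeType k z (parent G.graph a z) = σ ∧
      H.subtreeType k z' (parent H.graph a' z') = σ)) :
    SpoilerWins k G H (r + k + 1) [(z, z')] ∨
      SpoilerWins k G H r [(z, z'), (parent G.graph a z, parent H.graph a' z')] := by
  by_cases hu : G.subtreeType k z (parent G.graph a z) = σ ∨
    H.subtreeType k z' (parent H.graph a' z') = σ
  · exact .inr <| hB (adj_parent hG.connected haz).symm (adj_parent hH.connected haz').symm
      (fun h => hparent (hu.elim (fun hσ => ⟨hσ, h ▸ hσ⟩) fun hσ => ⟨h ▸ hσ, hσ⟩))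
      (hu.imp (by rintro rfl; exact hsize) (by rintro rfl; exact hsize))
  rw [not_or] at hu
  have hself := childCount_self hG haz (k := k) σ
  have hself' := childCount_self hH haz' (k := k) σ
  rw [if_neg hu.1, add_zero] at hself
  rw [if_neg hu.2, add_zero] at hself'
  rw [← hself, ← hself'] at hne
  exact .inl <| (hB.spoilerWins_of_childCount_self_ne hk hG hH hne fun _ _ => .inr hsize).mono
    (by omega) (List.Subset.refl _)

end BranchWins

theorem exists_childCount_ne (hG : G.IsTree) (hH : H.IsTree) (haz : a ≠ z) (haz' : a' ≠ z')
    (hcolor : G.color z = H.color z') (hroot : G.subtreeType k z z ≠ H.subtreeType k z' z')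
    (hne : G.subtreeType k a z ≠ H.subtreeType k a' z') :
    ∃ σ, min k (G.childCount k a z σ) ≠ min k (H.childCount k a' z' σ) ∧
      (min (G.childCount k a z σ) (H.childCount k a' z' σ) + 2 ≤ k ∨
        ¬ (G.subtreeType k z (parent G.graph a z) = σ ∧
          H.subtreeType k z' (parent H.graph a' z') = σ)) := by
  classical
  by_contra! hcon
  obtain ⟨σ, hσ⟩ : ∃ σ, min k (G.childCount k a z σ) ≠ min k (H.childCount k a' z' σ) := by
    by_contra! h
    exact hne (subtreeType_eq_iff.2 ⟨hcolor, h⟩)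
  obtain ⟨-, hu, hu'⟩ := hcon σ hσ
  refine hroot (subtreeType_eq_iff.2 ⟨hcolor, fun τ => ?_⟩)
  rw [childCount_self hG haz, childCount_self hH haz', hu, hu']
  by_cases hτ : min k (G.childCount k a z τ) = min k (H.childCount k a' z' τ)
  · split_ifs <;> omega
  · obtain ⟨hmany, huτ, -⟩ := hcon τ hτ
    rw [if_pos (hu ▸ huτ)]
    omega

theorem exists_ne_of_two_le_childCount (h : 2 ≤ G.childCount k a z σ) :
    ∃ x ∈ children G.graph a z, ∃ y ∈ children G.graph a z, x ≠ y ∧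
      G.subtreeType k a x = σ ∧ G.subtreeType k a y = σ := by
  classical
  obtain ⟨x, hx, y, hy, hxy⟩ := Finset.one_lt_card.1 h
  rw [Finset.mem_filter] at hx hy
  exact ⟨x, hx.1, y, hy.1, hxy, hx.2, hy.2⟩

/-- Spoiler distinguishes `z` from `z'` either by the children below them, or, if this would take
too many pebbles, by all neighbors, in which case the type counted occurs twice and so is small. -/
theorem BranchWins.spoilerWins_of_subtreeType_ne (hB : BranchWins k G H m r) (hk : 3 ≤ k)
    (hG : G.IsTree) (hH : H.IsTree) (ha : (a, a') ∈ L) (hz : (z, z') ∈ L) (haz : a ≠ z)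
    (hdist : G.graph.dist a z = H.graph.dist a' z') (hr : G.graph.dist a z ≤ 2 ^ r)
    (hroot : G.subtreeType k z z ≠ H.subtreeType k z' z')
    (hne : G.subtreeType k a z ≠ H.subtreeType k a' z')
    (hone : ∀ x ∈ children G.graph a z, ∀ y ∈ children G.graph a z, x ≠ y →
      (G.subtreeType k a x).size ≤ m ∨ (G.subtreeType k a y).size ≤ m)
    (hleft : ∀ x ∈ children G.graph a z, (G.subtreeType k a x).size ≤ m ∨
      ∃ x' ∈ children H.graph a' z', H.subtreeType k a' x' = G.subtreeType k a x)
    (hright : (∀ x ∈ children G.graph a z, (G.subtreeType k a x).size ≤ m) ∨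
      ∀ x' ∈ children H.graph a' z', ∃ x ∈ children G.graph a z,
        G.subtreeType k a x = H.subtreeType k a' x') :
    SpoilerWins k G H (r + k + 1) L := by
  by_cases hcolor : G.color z = H.color z'
  swap
  · exact .of_color hz hcolor
  have haz' := ne_of_dist_eq_dist hG.connected haz hdist
  have hparent {s : ℕ} (hrs : r ≤ s) (hsk : s ≤ r + k)
      (h : SpoilerWins k G H s [(z, z'), (parent G.graph a z, parent H.graph a' z')]) :
      SpoilerWins k G H (r + k + 1) L :=
    (SpoilerWins.of_parent hk hG hH ha hz haz hdist (hr.trans (by gcongr; norm_num)) h).mono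
      (by omega) (List.Subset.refl _)
  obtain ⟨σ, hσ, hgood⟩ := exists_childCount_ne hG hH haz haz' hcolor hroot hne
  have htwice (h : 2 ≤ G.childCount k a z σ) : σ.size ≤ m := by
    obtain ⟨x, hx, y, hy, hxy, rfl, hyσ⟩ := exists_ne_of_two_le_childCount h
    have := hone x hx y hy hxy
    rwa [hyσ, or_self] at this
  by_cases hfew : min (G.childCount k a z σ) (H.childCount k a' z' σ) + 2 ≤ k
  · refine hparent (Nat.le_add_right r k) le_rfl <| hB.spoilerWins_of_childCount_parent_ne
      hk hG hH haz haz' (fun h => hσ (by rw [h])) hfew (fun hgt => ?_) fun hlt x hx hxσ => ?_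
    · obtain ⟨x, hx, rfl⟩ := childCount_pos_iff.1 (Nat.zero_lt_of_lt hgt)
      refine (hleft x hx).elim id fun hx' => htwice ?_
      have := childCount_pos_iff.2 hx'
      omega
    · rw [← subtreeType_of_mem_children hG hx] at hxσ ⊢
      rcases (G.childCount k a z σ).eq_zero_or_pos with hzero | hpos
      · refine .inl (hright.elim (fun h => h x hx) fun h => ?_)
        obtain ⟨x', hx', rfl⟩ := childCount_pos_iff.1 (Nat.zero_lt_of_lt hlt)
        have := childCount_pos_iff.2 (h x' hx')
        omega
      · obtain ⟨y, hy, rfl⟩ := childCount_pos_iff.1 hpos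
        exact hone x hx y hy fun hxy => hxσ (hxy ▸ rfl)
  · rcases hB.spoilerWins_of_childCount_ne_of_size_le hk hG hH haz haz' hσ
      (htwice (by omega)) (hgood.resolve_left hfew) with h | h
    · exact h.mono le_rfl (by simpa using hz)
    · exact hparent le_rfl (Nat.le_add_right r k) h

end ColoredGraph

/-! ### Binary search along a path -/

namespace ColoredGraph

variable {C V W : Type*} [Fintype V] [Fintype W] {k m r s : ℕ} {G : ColoredGraph C V}
  {H : ColoredGraph C W} {a t z : V} {a' t' x' z' : W}

theorem one_lt_dist_of_subtreeType (hG : G.IsTree) (hH : H.IsTree) (hat : a ≠ t)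
    (hdist : G.graph.dist a t = H.graph.dist a' t')
    (htop : G.subtreeType k a (parent G.graph t a) ≠ H.subtreeType k a' (parent H.graph t' a'))
    (hbottom : G.subtreeType k a t = H.subtreeType k a' t') : 1 < G.graph.dist a t := by
  have hpos := hG.connected.pos_dist_of_ne hat
  by_contra! hone
  have hadj : G.graph.Adj a t := SimpleGraph.dist_eq_one_iff_adj.1 (by omega)
  have hadj' : H.graph.Adj a' t' := SimpleGraph.dist_eq_one_iff_adj.1 (by omega)
  rw [parent_of_adj hG hadj.symm, parent_of_adj hH hadj'.symm] at htop
  exact htop hbottom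

theorem size_add_dist_le_size_parent (hG : G.IsTree) (hk : 0 < k) (hat : a ≠ t) :
    (G.subtreeType k a t).size + G.graph.dist a t ≤
      (G.subtreeType k a (parent G.graph t a)).size + 1 := by
  have hself : Between G.graph a a t := by simp [Between]
  obtain ⟨hbetween, hdist, -⟩ := hself.step hG hat
  have := size_add_dist_le hG hk hbetween
  rw [SimpleGraph.dist_self] at hdist
  omega

theorem parent_mem_children_of_between (hG : G.IsTree) (h : Between G.graph a z t) (hz : z ≠ t) :
    parent G.graph t z ∈ children G.graph a z :=
  mem_children.2 ⟨(adj_parent hG.connected hz.symm).symm, (h.step hG hz).2.1⟩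

theorem exists_between_size_le (hG : G.IsTree) (hat : 1 < G.graph.dist a t)
    (hsize : (G.subtreeType k a (parent G.graph t a)).size ≤ (G.subtreeType k a t).size + m) :
    ∃ z, a ≠ z ∧ z ≠ t ∧ Between G.graph a z t ∧
      2 * (G.subtreeType k a (parent G.graph t a)).size ≤ 2 * (G.subtreeType k a z).size + m ∧
      2 * (G.subtreeType k z (parent G.graph t z)).size ≤ 2 * (G.subtreeType k a t).size + m := by
  classical
  let top := (G.subtreeType k a (parent G.graph t a)).size
  let s : Finset V := {z | a ≠ z ∧ z ≠ t ∧ Between G.graph a z t ∧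
    2 * top ≤ 2 * (G.subtreeType k a z).size + m}
  have hs {z : V} : z ∈ s ↔ a ≠ z ∧ z ≠ t ∧ Between G.graph a z t ∧
      2 * top ≤ 2 * (G.subtreeType k a z).size + m := by
    simp [s]
  have hne : a ≠ t := by
    rintro rfl
    simp at hat
  have hself : Between G.graph a a t := by simp [Between]
  have hstart : parent G.graph t a ∈ s := by
    obtain ⟨hbetween, hdist, -⟩ := hself.step hG hne
    rw [SimpleGraph.dist_self] at hdist
    refine hs.2 ⟨?_, ?_, hbetween, by omega⟩
    · exact ne_of_mem_children (parent_mem_children_of_between hG hself hne)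
    · intro h
      rw [h] at hdist
      omega
  obtain ⟨z, hz, hmax⟩ := s.exists_max_image (G.graph.dist a) ⟨_, hstart⟩
  obtain ⟨haz, hzt, hbetween, htop⟩ := hs.1 hz
  have hv := parent_mem_children_of_between hG hbetween hzt
  refine ⟨z, haz, hzt, hbetween, htop, ?_⟩
  rw [← subtreeType_of_mem_children hG hv]
  by_cases hvt : parent G.graph t z = t
  · rw [hvt]
    omega
  · obtain ⟨hbetween', hdist, -⟩ := hbetween.step hG hzt
    have hlarge : parent G.graph t z ∉ s := fun hmem => by
      have := hmax _ hmem
      omega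
    simp only [hs, not_and, not_le] at hlarge
    have := hlarge (ne_of_mem_children hv) hvt hbetween'
    omega

/-- Spoiler wins in `r` rounds from all positions in which two paths of the same length are pebbled
at their ends, the branches at their bottom ends have the same type, those at their first inner
vertices have different types, and the sizes of the types on the first path vary by at most `m`. -/
def PathWins (k : ℕ) (G : ColoredGraph C V) (H : ColoredGraph C W) (m r : ℕ) : Prop :=
  ∀ ⦃a t a' t'⦄, a ≠ t → G.graph.dist a t = H.graph.dist a' t' →
    G.subtreeType k a (parent G.graph t a) ≠ H.subtreeType k a' (parent H.graph t' a') →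
    G.subtreeType k a t = H.subtreeType k a' t' →
    (G.subtreeType k a (parent G.graph t a)).size ≤ (G.subtreeType k a t).size + m →
    SpoilerWins k G H r [(a, a'), (t, t')]

theorem PathWins.mono (h : PathWins k G H m r) (hrs : r ≤ s) : PathWins k G H m s :=
  fun _ _ _ _ hat hdist htop hbottom hsize =>
    (h hat hdist htop hbottom hsize).mono hrs (List.Subset.refl _)

theorem pathWins_zero (hk : 0 < k) (hG : G.IsTree) (hH : H.IsTree) : PathWins k G H 0 r := by
  intro a t a' t' hat hdist htop hbottom hsize
  have hone := one_lt_dist_of_subtreeType hG hH hat hdist htop hbottom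
  have hpath := size_add_dist_le_size_parent hG hk hat
  omega

/-- The distances to the ends of the path determine at which vertex a branch off the path is
attached, so Spoiler may pebble the root of such a branch directly. -/
theorem BranchWins.spoilerWins_of_unmatched_child (hB : BranchWins k G H m r) (hk : 3 ≤ k)
    (hG : G.IsTree) (hH : H.IsTree) (hz : Between G.graph a z t) (hz' : Between H.graph a' z' t')
    (hzt : z ≠ t) (hza : G.graph.dist a z = H.graph.dist a' z')
    (hdist : G.graph.dist z t = H.graph.dist z' t') (haz : a ≠ z)
    (hr : G.graph.dist a t ≤ 2 ^ r)
    (hx' : x' ∈ children H.graph a' z') (hpath : x' ≠ parent H.graph t' z')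
    (hne : ∀ x ∈ children G.graph a z, G.subtreeType k a x ≠ H.subtreeType k a' x')
    (hsize : ∀ x ∈ children G.graph a z, x ≠ parent G.graph t z →
      (G.subtreeType k a x).size ≤ m) :
    SpoilerWins k G H (r + 2) [(a, a'), (t, t')] := by
  have := hG.connected.nonempty
  have : 2 ^ r ≤ 2 ^ (r + 1) := by gcongr <;> omega
  have hztpos := hG.connected.pos_dist_of_ne hzt
  have hazpos := hG.connected.pos_dist_of_ne haz
  have hax' := (mem_children.1 hx').2
  have htx' := dist_of_ne_parent hH (mem_children.1 hx').1 hpath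
  rw [SimpleGraph.dist_comm (u := t') (v := z')] at htx'
  refine .step_right (r := r + 1) hk x' fun x => ?_
  by_cases hxa : H.graph.dist a' x' = G.graph.dist a x
  swap
  · exact .of_swap <| .of_dist_ne (x := a') (x' := a) (y := x') (y' := x) hk hH.connected
      hG.connected (by simp) (by simp) (by omega) hxa
  by_cases hxt : H.graph.dist t' x' = G.graph.dist t x
  swap
  · exact .of_swap <| .of_dist_ne (x := t') (x' := t) (y := x') (y' := x) hk hH.connected
      hG.connected (by simp) (by simp) (by omega) hxt
  rw [SimpleGraph.dist_comm (u := t)] at hxt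
  have hax : a ≠ x := by
    rintro rfl
    rw [SimpleGraph.dist_self] at hxa
    omega
  have hparent : parent G.graph a x = z := hz.parent_eq_of_dist hG (by omega) (by omega)
  have hx : x ∈ children G.graph a z := (mem_children_iff_parent hG).2 ⟨hax, hparent⟩
  have hxz : x ≠ parent G.graph t z := by
    rintro rfl
    have := (hz.step hG hzt).1
    have := (hz.step hG hzt).2.1
    omega
  refine .of_parent hk hG hH (a := a) (a' := a') (z := x) (z' := x') (by simp) (by simp) hax
    hxa.symm (by omega) ?_
  rw [hparent, parent_of_mem_children hH hx']
  refine (hB.of_mem_children hx hx' ?_ (.inl ?_)).mono le_rfl (by simp)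
  · rw [← subtreeType_of_mem_children hG hx, ← subtreeType_of_mem_children hH hx']
    exact hne x hx
  · rw [← subtreeType_of_mem_children hG hx]
    exact hsize x hx hxz

theorem BranchWins.spoilerWins_of_between (hB : BranchWins k G H m r) (hk : 3 ≤ k)
    (hG : G.IsTree) (hH : H.IsTree) (hz : Between G.graph a z t) (hz' : Between H.graph a' z' t')
    (hzt : z ≠ t) (hza : G.graph.dist a z = H.graph.dist a' z')
    (hdist : G.graph.dist z t = H.graph.dist z' t') (haz : a ≠ z)
    (hr : G.graph.dist a t ≤ 2 ^ r) (hroot : G.subtreeType k z z ≠ H.subtreeType k z' z')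
    (hne : G.subtreeType k a z ≠ H.subtreeType k a' z')
    (hv : G.subtreeType k z (parent G.graph t z) = H.subtreeType k z' (parent H.graph t' z'))
    (hsize : ∀ x ∈ children G.graph a z, x ≠ parent G.graph t z →
      (G.subtreeType k a x).size ≤ m) :
    SpoilerWins k G H (r + k + 1) [(z, z'), (a, a'), (t, t')] := by
  have hzt' := ne_of_dist_eq_dist hG.connected hzt hdist
  have hmem := parent_mem_children_of_between hG hz hzt
  have hmem' := parent_mem_children_of_between hH hz' hzt'
  rw [← subtreeType_of_mem_children hG hmem, ← subtreeType_of_mem_children hH hmem'] at hv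
  by_cases hmatch : ∀ x' ∈ children H.graph a' z', ∃ x ∈ children G.graph a z,
    G.subtreeType k a x = H.subtreeType k a' x'
  · refine hB.spoilerWins_of_subtreeType_ne hk hG hH (a := a) (a' := a') (z := z) (z' := z')
      (by simp) (by simp) haz hza ((Nat.le_add_right _ _).trans (hz.trans_le hr)) hroot hne
      (fun x hx y hy hxy => ?_) (fun x hx => ?_) (.inr hmatch)
    · by_cases hxv : x = parent G.graph t z
      · exact .inr (hsize y hy (hxv ▸ hxy.symm))
      · exact .inl (hsize x hx hxv)
    · by_cases hxv : x = parent G.graph t z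
      · exact .inr ⟨_, hmem', hxv ▸ hv.symm⟩
      · exact .inl (hsize x hx hxv)
  · push Not at hmatch
    obtain ⟨x', hx', hunmatched⟩ := hmatch
    refine (hB.spoilerWins_of_unmatched_child hk hG hH hz hz' hzt hza hdist haz hr hx' ?_
      hunmatched hsize).mono (by omega) (by simp)
    rintro rfl
    exact hunmatched _ hmem hv

theorem PathWins.step (hP : PathWins k G H (m / 2) (r + k + 1)) (hB : BranchWins k G H m r)
    (hk : 3 ≤ k) (hG : G.IsTree) (hH : H.IsTree)
    (hno : ∀ z z', G.subtreeType k z z ≠ H.subtreeType k z' z') (hm : m < 2 ^ r) :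
    PathWins k G H m (r + k + 2) := by
  intro a t a' t' hat hdist htop hbottom hsize
  have := hH.connected.nonempty
  have hone := one_lt_dist_of_subtreeType hG hH hat hdist htop hbottom
  have hpath := size_add_dist_le_size_parent hG (Nat.zero_lt_of_lt hk) hat
  have hpow : 2 ^ r ≤ 2 ^ (r + k + 1) := Nat.pow_le_pow_right two_pos (by omega)
  obtain ⟨z, haz, hzt, hz, hupper, hlower⟩ := exists_between_size_le hG hone hsize
  refine .step (r := r + k + 1) hk z fun z' => ?_
  by_cases hza : G.graph.dist a z = H.graph.dist a' z'
  swap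
  · exact .of_dist_ne (x := a) (x' := a') (y := z) (y' := z') hk hG.connected hH.connected
      (by simp) (by simp) (by omega) hza
  by_cases hzt' : G.graph.dist z t = H.graph.dist z' t'
  swap
  · exact .of_dist_ne (x := z) (x' := z') (y := t) (y' := t') hk hG.connected hH.connected
      (by simp) (by simp) (by omega) hzt'
  have hz' : Between H.graph a' z' t' := by omega
  have haz' := ne_of_dist_eq_dist hG.connected haz hza
  have hne_zt' := ne_of_dist_eq_dist hG.connected hzt hzt'
  by_cases hv : G.subtreeType k z (parent G.graph t z) = H.subtreeType k z' (parent H.graph t' z')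
  swap
  · rw [subtreeType_of_between hG hz hzt] at hbottom hlower
    rw [subtreeType_of_between hH hz' hne_zt'] at hbottom
    exact (hP hzt hzt' hv hbottom (by omega)).mono le_rfl (by simp)
  by_cases hne : G.subtreeType k a z = H.subtreeType k a' z'
  · rw [hz.symm.parent_eq hG haz.symm] at htop hupper
    rw [hz'.symm.parent_eq hH haz'.symm] at htop
    exact (hP haz hza htop hne (by omega)).mono le_rfl (by simp)
  refine hB.spoilerWins_of_between hk hG hH hz hz' hzt hza hzt' haz (by omega) (hno z z') hne hv
    fun x hx hxv => ?_
  have hmem := parent_mem_children_of_between hG hz hzt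
  have hsum := size_add_size_lt (k := k) (by omega) hx hmem hxv
  have hvt := size_add_dist_le (k := k) hG (by omega) (hz.step hG hzt).1
  have htopz := size_add_dist_le_size_parent hG (k := k) (by omega) haz
  rw [← hz.symm.parent_eq hG haz.symm] at htopz
  omega

end ColoredGraph

/-! ### Halving the size of a branch -/

namespace ColoredGraph

variable {C V W : Type*} [Fintype V] [Fintype W] {k m r : ℕ} {G : ColoredGraph C V}
  {H : ColoredGraph C W} {b w : V} {b' w' : W}

theorem exists_between_children_size_le (hG : G.IsTree) (b w : V)
    (hm : m < 2 * (G.subtreeType k b w).size) :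
    ∃ c, Between G.graph b w c ∧ m < 2 * (G.subtreeType k b c).size ∧
      ∀ x ∈ children G.graph b c, 2 * (G.subtreeType k b x).size ≤ m := by
  induction w using children_induction (G := G.graph) b with
  | h w ih =>
    by_cases hsmall : ∀ x ∈ children G.graph b w, 2 * (G.subtreeType k b x).size ≤ m
    · exact ⟨w, by simp [Between], hm, hsmall⟩
    push Not at hsmall
    obtain ⟨x, hx, hlarge⟩ := hsmall
    obtain ⟨c, hbetween, hc⟩ := ih x hx hlarge
    obtain ⟨hadj, hdist⟩ := mem_children.1 hx
    have hone := SimpleGraph.dist_eq_one_iff_adj.2 hadj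
    have htri := hG.connected.dist_triangle (u := b) (v := w) (w := c)
    have htri' := hG.connected.dist_triangle (u := w) (v := x) (w := c)
    exact ⟨c, by omega, hc⟩

theorem spoilerWins_of_size_le_one (hk : 3 ≤ k) (hG : G.IsTree)
    (hadj : G.graph.Adj b w) (hne : G.subtreeType k b w ≠ H.subtreeType k b' w')
    (hsize : (G.subtreeType k b w).size ≤ 1) :
    SpoilerWins k G H 1 [(b, b'), (w, w')] := by
  have := hG.connected.nonempty
  have hchildren : ∀ x, x ∉ children G.graph b w := fun x hx => by
    have hlt := size_subtreeType_lt (k := k) (Nat.zero_lt_of_lt hk) hx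
    have hpos := (G.subtreeType k b x).size_pos
    omega
  by_cases hcolor : G.color w = H.color w'
  swap
  · exact .of_color (x := w) (x' := w') (by simp) hcolor
  obtain ⟨x', hx'⟩ : ∃ x', x' ∈ children H.graph b' w' := by
    by_contra! hempty
    refine hne (subtreeType_eq_iff.2 ⟨hcolor, fun σ => ?_⟩)
    simp only [childCount, Finset.eq_empty_of_forall_notMem hchildren,
      Finset.eq_empty_of_forall_notMem hempty, Finset.filter_empty, Finset.card_empty]
  refine .step_right hk x' fun x => ?_
  by_cases hwx : G.graph.Adj w x
  · obtain rfl : x = b := by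
      by_contra hxb
      refine hchildren x ((mem_children_iff_ne_parent hG).2 ⟨hwx, ?_⟩)
      rwa [parent_of_adj hG hadj]
    exact .of_eq (x := x) (x' := x') (y := x) (y' := b') (by simp) (by simp)
      (by simp [(ne_of_mem_children hx').symm])
  · exact .of_adj (x := w) (x' := w') (y := x) (y' := x') (by simp) (by simp)
      (by simp [hwx, (mem_children.1 hx').1])

theorem branchWins_one (hk : 3 ≤ k) (hG : G.IsTree) (hH : H.IsTree) : BranchWins k G H 1 1 :=
  fun _ _ _ _ hadj hadj' hne hsize => hsize.elim
    (spoilerWins_of_size_le_one hk hG hadj hne)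
    fun hsize' => (spoilerWins_of_size_le_one hk hH hadj' hne.symm hsize').swap

theorem BranchWins.spoilerWins_of_size_le (hB : BranchWins k G H (m / 2) r)
    (hP : PathWins k G H (m / 2) (r + k + 2)) (hk : 3 ≤ k) (hG : G.IsTree) (hH : H.IsTree)
    (hno : ∀ z z', G.subtreeType k z z ≠ H.subtreeType k z' z') (hr : m / 2 < 2 ^ r)
    (hadj : G.graph.Adj b w) (hadj' : H.graph.Adj b' w')
    (hne : G.subtreeType k b w ≠ H.subtreeType k b' w')
    (hsize : (G.subtreeType k b w).size ≤ m) :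
    SpoilerWins k G H (r + k + 3) [(b, b'), (w, w')] := by
  have := hH.connected.nonempty
  have hpos := (G.subtreeType k b w).size_pos
  obtain ⟨c, hc, hlarge, hsmall⟩ :=
    exists_between_children_size_le (k := k) (m := (G.subtreeType k b w).size) hG b w (by omega)
  have hpath := size_add_dist_le (k := k) hG (by omega) hc
  have hbw := SimpleGraph.dist_eq_one_iff_adj.2 hadj
  have hbw' := SimpleGraph.dist_eq_one_iff_adj.2 hadj'
  have hpow : 2 ^ r ≤ 2 ^ (r + k + 2) := Nat.pow_le_pow_right two_pos (by omega)
  have hbc : b ≠ c := by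
    rintro rfl
    have hself := SimpleGraph.dist_self (G := G.graph) (v := b)
    omega
  refine .step (r := r + k + 2) hk c fun c' => ?_
  by_cases hdist : G.graph.dist b c = H.graph.dist b' c'
  swap
  · exact .of_dist_ne (x := b) (x' := b') (y := c) (y' := c') hk hG.connected hH.connected
      (by simp) (by simp) (by omega) hdist
  by_cases hdist' : G.graph.dist w c = H.graph.dist w' c'
  swap
  · exact .of_dist_ne (x := w) (x' := w') (y := c) (y' := c') hk hG.connected hH.connected
      (by simp) (by simp) (by omega) hdist'
  have hc' : Between H.graph b' w' c' := by omega
  by_cases htype : G.subtreeType k b c = H.subtreeType k b' c'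
  · refine (hP hbc hdist ?_ htype ?_).mono le_rfl (by simp)
    · rwa [hc.parent_eq_left hG hadj, hc'.parent_eq_left hH hadj']
    · rw [hc.parent_eq_left hG hadj]
      omega
  · have hchild : ∀ x ∈ children G.graph b c, (G.subtreeType k b x).size ≤ m / 2 := fun x hx => by
      have := hsmall x hx
      omega
    exact (hB.spoilerWins_of_subtreeType_ne (a := b) (a' := b') (z := c) (z' := c') hk hG hH
      (by simp) (by simp) hbc hdist (by omega) (hno c c') htype
      (fun x hx _ _ _ => .inl (hchild x hx)) (fun x hx => .inl (hchild x hx))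
      (.inl hchild)).mono (by omega) (List.Subset.refl _)

/-- The number of rounds in which Spoiler wins on branches whose types differ and have size at most
`m`. -/
def branchRounds (k m : ℕ) : ℕ := (k + 3) * Nat.log 2 m + 1

theorem branchRounds_eq_add (hm : 2 ≤ m) :
    branchRounds k m = branchRounds k (m / 2) + k + 3 := by
  rw [branchRounds, branchRounds, Nat.log_of_one_lt_of_le one_lt_two hm, mul_add]
  omega

theorem lt_two_pow_branchRounds : m < 2 ^ branchRounds k m :=
  (Nat.lt_pow_succ_log_self one_lt_two m).trans_le <| Nat.pow_le_pow_right two_pos <|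
    Nat.succ_le_succ (Nat.le_mul_of_pos_left _ (by omega))

theorem PathWins.of_branchWins (hk : 3 ≤ k) (hG : G.IsTree) (hH : H.IsTree)
    (hno : ∀ z z', G.subtreeType k z z ≠ H.subtreeType k z' z')
    (hB : ∀ n ≤ m, BranchWins k G H n (branchRounds k n)) :
    PathWins k G H m (branchRounds k m + k + 2) := by
  induction m using Nat.strong_induction_on with
  | _ m ih =>
    rcases Nat.lt_or_ge m 2 with hm | hm
    · refine .step ?_ (hB m le_rfl) hk hG hH hno lt_two_pow_branchRounds
      rw [Nat.div_eq_of_lt hm]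
      exact pathWins_zero (Nat.zero_lt_of_lt hk) hG hH
    · have hhalf := ih (m / 2) (by omega) fun n hn => hB n (by omega)
      refine .step (hhalf.mono ?_) (hB m le_rfl) hk hG hH hno lt_two_pow_branchRounds
      rw [branchRounds_eq_add hm]
      omega

theorem branchWins (hk : 3 ≤ k) (hG : G.IsTree) (hH : H.IsTree)
    (hno : ∀ z z', G.subtreeType k z z ≠ H.subtreeType k z' z') (m : ℕ) :
    BranchWins k G H m (branchRounds k m) := by
  induction m using Nat.strong_induction_on with
  | _ m ih =>
    rcases Nat.lt_or_ge m 2 with hm | hm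
    · exact (branchWins_one hk hG hH).mono (by omega) (Nat.le_add_left 1 _)
    have hpow := lt_two_pow_branchRounds (k := k) (m := m / 2)
    have hB : ∀ n ≤ m / 2, BranchWins k G H n (branchRounds k n) := fun n hn => ih n (by omega)
    rw [branchRounds_eq_add hm]
    rintro b w b' w' hadj hadj' hne (hsize | hsize)
    · exact (hB _ le_rfl).spoilerWins_of_size_le (.of_branchWins hk hG hH hno hB) hk hG hH hno hpow
        hadj hadj' hne hsize
    · exact ((hB _ le_rfl).swap.spoilerWins_of_size_le
        (.of_branchWins hk hH hG (fun z' z => (hno z z').symm) fun n hn => (hB n hn).swap)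
        hk hH hG (fun z' z => (hno z z').symm) hpow hadj' hadj hne.symm hsize).swap

end ColoredGraph

/-! ### The logarithmic bound -/

namespace ColoredGraph

variable {C V W : Type*} [Fintype V] [Fintype W] {k : ℕ} {G : ColoredGraph C V}
  {H : ColoredGraph C W} {z : V}

theorem mul_log_two_mul {m : ℕ} (hm : 0 < m) :
    (k + 3) * Nat.log 2 (2 * m) = branchRounds k m + k + 2 := by
  have h := branchRounds_eq_add (k := k) (m := 2 * m) (by omega)
  rw [Nat.mul_div_cancel_left m two_pos, branchRounds] at h
  omega

theorem exists_spoilerWins_of_centroid (hk : 3 ≤ k) (hG : G.IsTree) (hH : H.IsTree)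
    (hno : ∀ z z', G.subtreeType k z z ≠ H.subtreeType k z' z')
    (hn : 2 ≤ Fintype.card V)
    (hz : ∀ x ∈ children G.graph z z, 2 * (subtree G.graph z x).card ≤ Fintype.card V)
    (z' : W) :
    ∃ N s, SpoilerWins k G H s [(z, z')] ∧
      (s + 1 < (k + 3) * Nat.log 2 N ∧ N ≤ Fintype.card V ∨
        s + 1 ≤ (k + 3) * Nat.log 2 N ∧ N < Fintype.card V) := by
  by_cases hcolor : G.color z = H.color z'
  swap
  · exact ⟨2, 0, .of_color (by simp) hcolor, .inl ⟨by norm_num, hn⟩⟩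
  obtain ⟨σ, hσ⟩ : ∃ σ, min k (G.childCount k z z σ) ≠ min k (H.childCount k z' z' σ) := by
    by_contra! h
    exact hno z z' (subtreeType_eq_iff.2 ⟨hcolor, h⟩)
  by_cases hfew : min (G.childCount k z z σ) (H.childCount k z' z' σ) + 2 ≤ k
  · have hwins := (branchWins hk hG hH hno (Fintype.card V / 2)).spoilerWins_of_childCount_self_ne
      hk hG hH hσ fun x hx => .inl ?_
    · refine ⟨_, _, hwins, .inl ⟨?_, Nat.mul_div_le _ 2⟩⟩
      rw [mul_log_two_mul (by omega)]
      omega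
    · have hle := size_subtreeType_le_card (k := k) hG z x
      have := hz x hx
      omega
  · have hwins := (branchWins hk hG hH hno σ.size).spoilerWins_of_childCount_self_ne
      hk hG hH hσ fun _ _ => .inr le_rfl
    have hsize : 2 * σ.size < Fintype.card V :=
      two_mul_size_lt_of_childCount (k := k) (z := z) hG (by omega) (by omega)
    refine ⟨_, _, hwins, .inr ⟨?_, hsize⟩⟩
    rw [mul_log_two_mul σ.size_pos]
    omega

end ColoredGraph

theorem natCast_mul_log_le (c N : ℕ) : ((c * Nat.log 2 N : ℕ) : ℝ) ≤ c * Real.logb 2 N := by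
  rw [Nat.cast_mul]
  gcongr
  exact_mod_cast Real.natLog_le_logb N 2

theorem lt_mul_logb_of_log {c s N n : ℕ} (hs : 0 < s)
    (h : s < c * Nat.log 2 N ∧ N ≤ n ∨ s ≤ c * Nat.log 2 N ∧ N < n) :
    (s : ℝ) < c * Real.logb 2 n := by
  have hpos : 0 < c * Nat.log 2 N := by omega
  have hc : (0 : ℝ) < c := by exact_mod_cast Nat.pos_of_mul_pos_right hpos
  have hN : (0 : ℝ) < N := by
    refine Nat.cast_pos.2 (Nat.pos_of_ne_zero ?_)
    rintro rfl
    simp at hpos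
  have hlog := natCast_mul_log_le c N
  rcases h with ⟨hs, hn⟩ | ⟨hs, hn⟩
  · calc (s : ℝ) < (c * Nat.log 2 N : ℕ) := by exact_mod_cast hs
      _ ≤ c * Real.logb 2 N := hlog
      _ ≤ c * Real.logb 2 n := by gcongr; norm_num
  · calc (s : ℝ) ≤ (c * Nat.log 2 N : ℕ) := by exact_mod_cast hs
      _ ≤ c * Real.logb 2 N := hlog
      _ < c * Real.logb 2 n := by gcongr; norm_num

theorem exists_eq_natCast_lt_of_le {d : ℕ∞} {x : ℝ} (hx : 0 < x)
    (h : d ≤ (⌈x⌉₊ - 1 : ℕ)) : ∃ r : ℕ, d = r ∧ (r : ℝ) < x := by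
  lift d to ℕ using ne_top_of_le_ne_top (ENat.natCast_ne_top _) h
  rw [Nat.cast_le] at h
  have := Nat.ceil_pos.2 hx
  exact ⟨d, rfl, Nat.lt_ceil.1 (by omega)⟩

theorem mul_logb_pos (k : ℕ) {n : ℕ} (hn : 2 ≤ n) : 0 < ((k : ℝ) + 3) * Real.logb 2 n :=
  mul_pos (by positivity) (Real.logb_pos one_lt_two (by exact_mod_cast hn))

theorem distDepth_le_ceil {k : ℕ} (hk : 3 ≤ k) {C V W : Type*} [Finite V] [Finite W]
    {G : ColoredGraph C V} {H : ColoredGraph C W} (hG : G.IsTree) (hH : H.IsTree)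
    (hn : 2 ≤ Nat.card V) (h : ∃ φ : FOk C k, φ.Distinguishes G H) :
    distDepth k G H ≤ (⌈((k : ℝ) + 3) * Real.logb 2 (Nat.card V)⌉₊ - 1 : ℕ) := by
  have := Fintype.ofFinite V
  have := Fintype.ofFinite W
  have := hG.connected.nonempty
  have := hH.connected.nonempty
  obtain ⟨φ, hφ⟩ := h
  rw [Nat.card_eq_fintype_card] at hn ⊢
  obtain ⟨z, hz⟩ := exists_centroid hG
  have hwins (z' : W) : ∃ s, SpoilerWins k G H s [(z, z')] ∧
      s + 1 < ⌈((k : ℝ) + 3) * Real.logb 2 (Fintype.card V)⌉₊ := by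
    obtain ⟨N, s, hs, hN⟩ := ColoredGraph.exists_spoilerWins_of_centroid hk hG hH
      (fun z z' heq => ColoredGraph.not_distinguishes hG hH heq φ hφ) hn hz z'
    exact ⟨s, hs, Nat.lt_ceil.2 (by simpa using lt_mul_logb_of_log s.succ_pos hN)⟩
  obtain ⟨s, -, hs⟩ := hwins (Classical.arbitrary W)
  obtain ⟨t, ht⟩ := Nat.exists_eq_add_of_lt hs
  simp only [ht] at hwins ⊢
  refine (SpoilerWins.step (r := s + t) (by simp only [List.length_nil]; omega) z fun z' => ?_
    ).distDepth_le.trans (Nat.cast_le.2 (by omega))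
  obtain ⟨s', hwin, hs'⟩ := hwins z'
  exact hwin.mono (by omega) (List.Subset.refl _)

theorem exists_distinguishes_of_distDepth_lt_top {k : ℕ} {C V W : Type*} {G : ColoredGraph C V}
    {H : ColoredGraph C W} (h : distDepth k G H < ⊤) : ∃ φ : FOk C k, φ.Distinguishes G H := by
  by_contra! hcon
  simp [distDepth, hcon] at h

theorem exists_distDepth_eq {k : ℕ} (hk : 3 ≤ k) {C V W : Type*} [Finite V] [Finite W]
    {G : ColoredGraph C V} {H : ColoredGraph C W} (hG : G.IsTree) (hH : H.IsTree)
    (hn : 2 ≤ Nat.card V) (h : distDepth k G H < ⊤) :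
    ∃ r : ℕ, distDepth k G H = r ∧ (r : ℝ) < ((k : ℝ) + 3) * Real.logb 2 (Nat.card V) :=
  exists_eq_natCast_lt_of_le (mul_logb_pos k hn) <|
    distDepth_le_ceil hk hG hH hn (exists_distinguishes_of_distDepth_lt_top h)

theorem exists_treeAltFun_eq {k n : ℕ} (hk : 3 ≤ k) (hn : 2 ≤ n) :
    ∃ a : ℕ, treeAltFun.{u, v, w} k n = a ∧ (a : ℝ) < ((k : ℝ) + 3) * Real.logb 2 n := by
  refine exists_eq_natCast_lt_of_le (mul_logb_pos k hn) (sSup_le ?_)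
  rintro a ⟨C, V, W, T, T', _, _, rfl, -, hT, hT', hφ, rfl⟩
  exact (distAlt_le_distDepth k T T').trans (distDepth_le_ceil hk hT hT' hn hφ)

theorem treeAltFun_isBigO_log {k : ℕ} (hk : 3 ≤ k) :
    (fun n : ℕ => ((treeAltFun.{u, v, w} k n).toNat : ℝ))
      =O[Filter.atTop] (fun n : ℕ => Real.log (n : ℝ)) := by
  refine Asymptotics.IsBigO.of_bound (((k : ℝ) + 3) / Real.log 2) ?_
  filter_upwards [Filter.eventually_ge_atTop 2] with n hn
  obtain ⟨a, ha, hbound⟩ := exists_treeAltFun_eq.{u, v, w} hk hn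
  rw [ha, ENat.toNat_natCast, Real.norm_of_nonneg (Nat.cast_nonneg a),
    Real.norm_of_nonneg (Real.log_natCast_nonneg n), div_mul_eq_mul_div, mul_div_assoc]
  exact hbound.le

theorem theorem3 (k : ℕ) (hk : 3 ≤ k) :
    (∀ (C : Type u) (V : Type v) (V' : Type w) [Finite V] [Finite V']
        (T : ColoredGraph C V) (T' : ColoredGraph C V'),
        T.IsTree → T'.IsTree → 2 ≤ Nat.card V → distDepth k T T' < ⊤ →
        ∃ r : ℕ, distDepth k T T' = (r : ℕ∞) ∧
          (r : ℝ) < ((k : ℝ) + 3) * Real.logb 2 (Nat.card V : ℝ)) ∧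
    (∀ n : ℕ, 2 ≤ n →
        ∃ a : ℕ, treeAltFun.{u, v, w} k n = (a : ℕ∞) ∧
          (a : ℝ) < ((k : ℝ) + 3) * Real.logb 2 (n : ℝ)) ∧
    (fun n : ℕ => ((treeAltFun.{u, v, w} k n).toNat : ℝ))
      =O[Filter.atTop] (fun n : ℕ => Real.log (n : ℝ)) :=
  ⟨fun _ _ _ _ _ _ _ hT hT' hn h => exists_distDepth_eq hk hT hT' hn h,
    fun _ hn => exists_treeAltFun_eq hk hn, treeAltFun_isBigO_log hk⟩
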